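/- **Setting.** Let $\mathcal G$ be a connected graph on $m\ge 2$ agents, $d\ge 1$, and let $\mathcal A=\mathcal L\otimes I_d$, where $\mathcal L$ is the graph Laplacian, or $\mathcal A=\mathcal B^\top\otimes I_d$, where $\mathcal B$ is an oriented incidence matrix. Let $\|\cdot\|$ be a norm on $\mathbb R^d$ with dual norm $\|\cdot\|_*$, extended to $\mathbb R^{md}$ by $\|x\|^2=\sum_i\|x^{(i)}\|^2$, and let $\|\mathcal A\|=\sup\{\|\mathcal Ax\|_2:\|x\|\le 1\}$. Let $\mu\ge0$, $\tilde L>0$. For each agent $i$ let $X^{(i)}\subseteq\mathbb R^d$ be closed and convex, let $\tilde f_i:\mathbb R^d\to\mathbb R$ be convex and differentiable with $\|\nabla\tilde f_i(x)-\nabla\tilde f_i(y)\|_*\le\tilde L\|x-y\|$, and let $\nu_i:X^{(i)}\to\mathbb R$ be differentiable on $X^{(i)}$ and strongly convex with modulus $1$ with respect to $\|\cdot\|$. Put $\mathcal X=\prod_iX^{(i)}$, $f(x)=\sum_i\big(\tilde f_i(x^{(i)})+\mu\nu_i(x^{(i)})\big)$, $V_i(a,x)=\nu_i(x)-\nu_i(a)-\langle\nu_i'(a),x-a\rangle$,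 $V(a,x)=\sum_iV_i(a^{(i)},x^{(i)})$. Let $(x^*,z^*)$ be a saddle point of $\min_{x\in\mathcal X}\max_z f(x)+\langle\mathcal Ax,z\rangle$. A point $x\in\mathcal X$ is an $\varepsilon$-solution if $f(x)-f(x^*)\le\varepsilon$ and $\|\mathcal Ax\|_2\le\varepsilon$. **Algorithm (PDS).** Choose $x_0,\underline x_0\in\mathcal X$; set $\hat x_0=x_{-1}=x_0$, $z_0=0$. For $k=1,\dots,N$ compute $$\tilde x_k=x_{k-1}+\lambda_k(\hat x_{k-1}-x_{k-2}),\quad \underline x_k=\frac{\tilde x_k+\tau_k\underline x_{k-1}}{1+\tau_k},\quad y_k^{(i)}=\nabla\tilde f_i(\underline x_k^{(i)}),$$ set $x_k^0=x_{k-1}$, $z_k^0=z_{k-1}$, $x_k^{-1}=x_{k-1}^{T_{k-1}-1}$ ($x_1^{-1}=x_0$), and for $t=1,\dots,T_k$ compute $$\tilde u_k^t=x_k^{t-1}+\alpha_k^t(x_k^{t-1}-x_k^{t-2}),\qquad z_k^t=\operatorname*{argmin}_z\ \langle-\mathcal A\tilde u_k^t,z\rangle+\tfrac{q_k^t}2\|z-z_k^{t-1}\|_2^2,$$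 $$x_k^t=\operatorname*{argmin}_{x\in\mathcal X}\ \mu\nu(x)+\langle y_k+\mathcal A^\top z_k^t,x\rangle+\eta_k^tV(x_k^{t-1},x)+p_kV(x_{k-1},x),\qquad \nu(x)=\textstyle\sum_i\nu_i(x^{(i)})$$ (all steps are separable over the agents); then set $x_k=x_k^{T_k}$, $z_k=z_k^{T_k}$, $\hat x_k=\frac1{T_k}\sum_{t=1}^{T_k}x_k^t$. The output is $\overline x_N=\big(\sum_{k=1}^N\beta_k\big)^{-1}\sum_{k=1}^N\beta_k\hat x_k$. Each outer iteration uses one gradient evaluation (per agent) and each inner iteration two communication rounds (one for $\mathcal A\tilde u_k^t$, one for $\mathcal A^\top z_k^t$). **Parameters.** If $\mu>0$ let $\tau=\sqrt{2\tilde L/\mu}$, $\Delta=\lceil2\tau+1\rceil$, $\lambda=\tau/(1+\tau)$; if $\mu=0$ let $\Delta=+\infty$. Let $R>0$. For $k\le\Delta$: $$\tau_k=\tfrac{k-1}2,\quad\lambda_k=\tfrac{k-1}k,\quad\beta_k=k,\quad p_k=\tfrac{2\tilde L}k,\quad T_k=\Big\lceil\tfrac{kR\|\mathcal A\|}{\tilde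 L}\Big\rceil;$$ for $k>\Delta$: $$\tau_k=\tau,\quad\lambda_k=\lambda,\quad\beta_k=\Delta\lambda^{-(k-\Delta)},\quad p_k=\tfrac{\tilde L}{1+\tau},\quad T_k=\Big\lceil\tfrac{2(1+\tau)R\|\mathcal A\|}{\tilde L\lambda^{(k-\Delta)/2}}\Big\rceil;$$ for all $k,t$: $\eta_k^t=(p_k+\mu)(t-1)+p_kT_k$, $q_k^t=\frac{\tilde LT_k}{2\beta_kR^2}$, and $\alpha_k^t=\frac{\beta_{k-1}T_k}{\beta_kT_{k-1}}$ if $k\ge2$ and $t=1$, $\alpha_k^t=1$ otherwise. **Theorem.** For every $N\ge1$ one has $\overline x_N\in\mathcal X$ and $$f(\overline x_N)-f(x^*)\le\min\big\{\tfrac2{N^2},\lambda^{N-\Delta}\big\}\,4\tilde LV(x_0,x^*),$$ $$\|\mathcal A\overline x_N\|_2\le\min\big\{\tfrac2{N^2},\lambda^{N-\Delta}\big\}\Big[\tfrac{\tilde L}{4R^2}(\|z^*\|_2+1)^2+4\tilde LV(x_0,x^*)\Big],$$ where the minimum is read as $2/N^2$ if $\mu=0$. Moreover, let $x_0\ne x^*$,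 $R=\frac{\|z^*\|_2+1}{4\sqrt{V(x_0,x^*)}}$ and $\varepsilon>0$. a) If $\mu=0$, then for $N=\lceil4\sqrt{\tilde LV(x_0,x^*)/\varepsilon}\,\rceil$ the output $\overline x_N$ is an $\varepsilon$-solution, obtained with at most $N$ gradient evaluations and at most $$2N+\max\Big\{\frac{96\,V(x_0,x^*)}{\varepsilon},\frac2{\tilde L}\Big\}R\,\|\mathcal A\|$$ communication rounds; for $\varepsilon\le48\tilde LV(x_0,x^*)$ this is $2N+96\,R\,V(x_0,x^*)\|\mathcal A\|/\varepsilon=2N+24(\|z^*\|_2+1)\sqrt{V(x_0,x^*)}\,\|\mathcal A\|/\varepsilon$. b) If $\mu>0$, then for some $N$ the output $\overline x_N$ is an $\varepsilon$-solution, obtained with at most $N$ gradient evaluations and at most $2N+C_2\|\mathcal A\|(1+1/\sqrt\varepsilon)$ communication rounds, where $$N\le C_1\Big(1+\sqrt{\tilde L/\mu}\,\max\big\{0,\log(\tilde LV(x_0,x^*)/\varepsilon)\big\}\Big).$$ Here $C_1$ depends only on an arbitrary positive lower bound $\kappa$ of $\tilde L/\mu$ (so it is universal if $\tilde L\ge\mu$),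 and $C_2$ depends only on $\tilde L,\mu,V(x_0,x^*),\|z^*\|_2$; neither depends on $N$, $\mathcal A$ or $\varepsilon$. -/

import Mathlib

open Finset

noncomputable section

namespace PDS

/-- The space `ℝ^d` of one agent, with its Euclidean inner product. -/
abbrev Loc (d : ℕ) : Type := EuclideanSpace ℝ (Fin d)

/-- `ℝ^{|ρ| d}`: families of vectors of `ℝ^d` indexed by `ρ`, with the Euclidean norm of the product. -/
abbrev Net (ρ : Type) (d : ℕ) : Type := PiLp 2 (fun _ : ρ => Loc d)

/-- `M` is, up to a relabelling of its rows, the graph Laplacian of `G` or the transpose of an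
oriented incidence matrix of `G`. -/
def IsNetworkMatrix {m : ℕ} {ρ : Type} (G : SimpleGraph (Fin m)) (M : Matrix ρ (Fin m) ℝ) : Prop :=
  (∃ e : ρ ≃ Fin m, ∀ r j, M r j = open Classical in G.lapMatrix ℝ (e r) j) ∨
  (∃ (e : ρ ≃ G.edgeSet) (head tail : ρ → Fin m), ∀ r,
    (e r : Sym2 (Fin m)) = s(tail r, head r) ∧
    ∀ j, M r j = if j = head r then 1 else if j = tail r then -1 else 0)

/-- The dual norm `‖y‖_* = sup {⟨y, v⟩ : ‖v‖ ≤ 1}` of a norm `p` on `ℝ^d`. -/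
def dualNorm {d : ℕ} (p : Seminorm ℝ (Loc d)) (y : Loc d) : ℝ :=
  sSup {r | ∃ v : Loc d, p v ≤ 1 ∧ r = inner ℝ y v}

/-- `g` is strongly convex on `s` with modulus `1` with respect to the norm `p`. -/
def StronglyConvexOn {d : ℕ} (p : Seminorm ℝ (Loc d)) (s : Set (Loc d)) (g : Loc d → ℝ) : Prop :=
  Convex ℝ s ∧ ∀ x ∈ s, ∀ y ∈ s, ∀ a b : ℝ, 0 ≤ a → 0 ≤ b → a + b = 1 →
    g (a • x + b • y) ≤ a * g x + b * g y - a * b * (1 / 2 * p (x - y) ^ 2)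

/-- A minimizer of `φ` over `s` (an arbitrary point if there is none). -/
def argmin {d : ℕ} (s : Set (Loc d)) (φ : Loc d → ℝ) : Loc d :=
  Classical.epsilon fun x => x ∈ s ∧ IsMinOn φ s x

/-- The data of a decentralized problem with `m` agents in `ℝ^d`: the communication graph `G`, the
matrix `M` with `𝒜 = M ⊗ I_d`, the constraint sets `X i`, the local objectives `ft i + μ ν i`,
the constants `μ` and `L`, and the norm `p` on `ℝ^d`. -/
structure Problem (m d : ℕ) (ρ : Type) where
  G : SimpleGraph (Fin m)
  M : Matrix ρ (Fin m) ℝ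
  X : Fin m → Set (Loc d)
  ft : Fin m → Loc d → ℝ
  ν : Fin m → Loc d → ℝ
  μ : ℝ
  L : ℝ
  p : Seminorm ℝ (Loc d)

namespace Problem

variable {m d : ℕ} {ρ : Type}

/-- The standing assumptions on the problem. The functions `ft i` live on all of `ℝ^d`, because the
algorithm evaluates their gradients at extrapolated points that may lie outside `X i`; only the
values of `ν i` on `X i` matter. -/
structure Assumptions (P : Problem m d ρ) : Prop where
  two_le_m : 2 ≤ m
  one_le_d : 1 ≤ d
  connected : P.G.Connected
  network : IsNetworkMatrix P.G P.M
  mu_nonneg : 0 ≤ P.μ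
  L_pos : 0 < P.L
  p_definite : ∀ x, P.p x = 0 → x = 0
  X_closed : ∀ i, IsClosed (P.X i)
  X_convex : ∀ i, Convex ℝ (P.X i)
  ft_convex : ∀ i, ConvexOn ℝ Set.univ (P.ft i)
  ft_differentiable : ∀ i, Differentiable ℝ (P.ft i)
  ft_lipschitz : ∀ i x y,
    dualNorm P.p (gradient (P.ft i) x - gradient (P.ft i) y) ≤ P.L * P.p (x - y)
  nu_differentiable : ∀ i, DifferentiableOn ℝ (P.ν i) (P.X i)
  nu_strongly_convex : ∀ i, StronglyConvexOn P.p (P.X i) (P.ν i)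

/-- `𝒳 = X 1 × ⋯ × X m`. -/
def feasible (P : Problem m d ρ) : Set (Net (Fin m) d) := {x | ∀ i, x i ∈ P.X i}

/-- The overall objective `f = f̃ + μ ν`. -/
def f (P : Problem m d ρ) (x : Net (Fin m) d) : ℝ :=
  ∑ i, (P.ft i (x i) + P.μ * P.ν i (x i))

/-- `𝒜 = M ⊗ I_d`. -/
def A (P : Problem m d ρ) (x : Net (Fin m) d) : Net ρ d :=
  WithLp.toLp 2 fun r => ∑ i, P.M r i • x i

/-- `𝒜ᵀ = Mᵀ ⊗ I_d`. -/
def AT [Fintype ρ] (P : Problem m d ρ) (z : Net ρ d) : Net (Fin m) d :=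
  WithLp.toLp 2 fun i => ∑ r, P.M r i • z r

/-- The norm on `ℝ^{md}` built from the norm `p` on each block: `‖x‖² = ∑ i, ‖x i‖²`. -/
def netNorm (P : Problem m d ρ) (x : Net (Fin m) d) : ℝ := √(∑ i, P.p (x i) ^ 2)

/-- `‖𝒜‖`: the operator norm of `𝒜` from `ℝ^{md}` with `netNorm` to the Euclidean norm. It is the
spectral norm if `p` is the Euclidean norm. -/
def opNorm [Fintype ρ] (P : Problem m d ρ) : ℝ :=
  sSup {r | ∃ x : Net (Fin m) d, P.netNorm x ≤ 1 ∧ r = ‖P.A x‖}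

/-- The prox-function `V_i(a, x) = ν_i(x) - ν_i(a) - ⟨ν_i'(a), x - a⟩` for `a, x ∈ X i`. -/
def Vi (P : Problem m d ρ) (i : Fin m) (a x : Loc d) : ℝ :=
  P.ν i x - P.ν i a - fderivWithin ℝ (P.ν i) (P.X i) a (x - a)

/-- `V(a, x) = ∑ i, V_i(a i, x i)`. -/
def V (P : Problem m d ρ) (a x : Net (Fin m) d) : ℝ := ∑ i, P.Vi i (a i) (x i)

/-- `(xs, zs)` is a saddle point of `min_{x ∈ 𝒳} max_z f(x) + ⟨𝒜 x, z⟩`. -/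
def IsSaddle [Fintype ρ] (P : Problem m d ρ) (xs : Net (Fin m) d) (zs : Net ρ d) : Prop :=
  xs ∈ P.feasible ∧
  (∀ z, P.f xs + inner ℝ (P.A xs) z ≤ P.f xs + inner ℝ (P.A xs) zs) ∧
  (∀ x ∈ P.feasible, P.f xs + inner ℝ (P.A xs) zs ≤ P.f x + inner ℝ (P.A x) zs)

/-- `x` is an `ε`-solution of `min {f(x) : x ∈ 𝒳, 𝒜 x = 0}`, whose optimal solution is `xs`. -/
def IsEpsSolution [Fintype ρ] (P : Problem m d ρ) (xs : Net (Fin m) d) (ε : ℝ)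
    (x : Net (Fin m) d) : Prop :=
  x ∈ P.feasible ∧ P.f x - P.f xs ≤ ε ∧ ‖P.A x‖ ≤ ε

/-! The parameters. -/

/-- `τ = √(2 L / μ)` (used only if `μ > 0`). -/
def tau (P : Problem m d ρ) : ℝ := √(2 * P.L / P.μ)

/-- `Δ = ⌈2 τ + 1⌉` (used only if `μ > 0`; for `μ = 0` one has `Δ = ∞`, see `early`). -/
def Delta (P : Problem m d ρ) : ℕ := ⌈2 * P.tau + 1⌉₊

/-- `λ = τ / (1 + τ)` (used only if `μ > 0`). -/
def lam (P : Problem m d ρ) : ℝ := P.tau / (1 + P.tau)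

/-- The condition `k ≤ Δ`, where `Δ = ∞` if `μ = 0`. -/
def early (P : Problem m d ρ) (k : ℕ) : Prop := P.μ = 0 ∨ k ≤ P.Delta

open Classical in
def tauK (P : Problem m d ρ) (k : ℕ) : ℝ :=
  if P.early k then ((k : ℝ) - 1) / 2 else P.tau

open Classical in
def lamK (P : Problem m d ρ) (k : ℕ) : ℝ :=
  if P.early k then ((k : ℝ) - 1) / k else P.lam

open Classical in
def betaK (P : Problem m d ρ) (k : ℕ) : ℝ :=
  if P.early k then k else P.Delta * P.lam ^ (-((k : ℝ) - P.Delta))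

open Classical in
def pK (P : Problem m d ρ) (k : ℕ) : ℝ :=
  if P.early k then 2 * P.L / k else P.L / (1 + P.tau)

open Classical in
def TK [Fintype ρ] (P : Problem m d ρ) (R : ℝ) (k : ℕ) : ℕ :=
  if P.early k then ⌈k * R * P.opNorm / P.L⌉₊
  else ⌈2 * (1 + P.tau) * R * P.opNorm / (P.L * P.lam ^ (((k : ℝ) - P.Delta) / 2))⌉₊

def etaKT [Fintype ρ] (P : Problem m d ρ) (R : ℝ) (k t : ℕ) : ℝ :=
  (P.pK k + P.μ) * ((t : ℝ) - 1) + P.pK k * P.TK R k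

/-- `q_k^t`, which does not depend on `t`. -/
def qK [Fintype ρ] (P : Problem m d ρ) (R : ℝ) (k : ℕ) : ℝ :=
  P.L * P.TK R k / (2 * P.betaK k * R ^ 2)

def alphaKT [Fintype ρ] (P : Problem m d ρ) (R : ℝ) (k t : ℕ) : ℝ :=
  if 2 ≤ k ∧ t = 1 then P.betaK (k - 1) * P.TK R k / (P.betaK k * P.TK R (k - 1)) else 1

/-- `min {2 / N², λ^(N - Δ)}`, which is `2 / N²` if `μ = 0`. -/
def rate (P : Problem m d ρ) (N : ℕ) : ℝ :=
  open Classical in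
  if P.μ = 0 then 2 / (N : ℝ) ^ 2 else min (2 / (N : ℝ) ^ 2) (P.lam ^ ((N : ℝ) - P.Delta))

end Problem

/-! The algorithm. -/

/-- The state of the inner loop after `t` inner iterations: `xOld = x_k^{t-1}`, `x = x_k^t`,
`z = z_k^t`, and the number of communication rounds so far. -/
structure Inner (m d : ℕ) (ρ : Type) where
  xOld : Net (Fin m) d
  x : Net (Fin m) d
  z : Net ρ d
  comms : ℕ

/-- The state after `k` outer iterations: `xPrev = x_{k-1}`, `x = x_k`, `xTail = x_k^{T_k - 1}`,
`xHat = x̂_k`, `xLow = x̲_k`, `z = z_k`, and the numbers of gradient evaluations (of all `∇ f̃_i`,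
one per agent) and of communication rounds so far. -/
structure Outer (m d : ℕ) (ρ : Type) where
  xPrev : Net (Fin m) d
  x : Net (Fin m) d
  xTail : Net (Fin m) d
  xHat : Net (Fin m) d
  xLow : Net (Fin m) d
  z : Net ρ d
  grads : ℕ
  comms : ℕ

namespace Problem

variable {m d : ℕ} {ρ : Type} [Fintype ρ]

/-- The `t`-th inner iteration of the `k`-th outer iteration, with `xPrev = x_{k-1}` and `y = y_k`.
It takes two rounds of communication, one for `𝒜 ũ_k^t` and one for `𝒜ᵀ z_k^t`. -/
def innerStep (P : Problem m d ρ) (R : ℝ) (k t : ℕ) (xPrev y : Net (Fin m) d)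
    (s : Inner m d ρ) : Inner m d ρ :=
  let u : Net (Fin m) d := s.x + P.alphaKT R k t • (s.x - s.xOld)
  let z : Net ρ d := WithLp.toLp 2 fun r =>
    argmin Set.univ fun w => inner ℝ (-(P.A u) r) w + P.qK R k / 2 * ‖w - s.z r‖ ^ 2
  let x : Net (Fin m) d := WithLp.toLp 2 fun i =>
    argmin (P.X i) fun w => P.μ * P.ν i w + inner ℝ (y i + (P.AT z) i) w
      + P.etaKT R k t * P.Vi i (s.x i) w + P.pK k * P.Vi i (xPrev i) w
  { xOld := s.x, x := x, z := z, comms := s.comms + 2 }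

/-- The state of the inner loop after `t` iterations, starting from `s`. -/
def innerIter (P : Problem m d ρ) (R : ℝ) (k : ℕ) (xPrev y : Net (Fin m) d)
    (s : Inner m d ρ) : ℕ → Inner m d ρ
  | 0 => s
  | t + 1 => P.innerStep R k (t + 1) xPrev y (innerIter P R k xPrev y s t)

/-- The `k`-th outer iteration. -/
def outerStep (P : Problem m d ρ) (R : ℝ) (k : ℕ) (s : Outer m d ρ) : Outer m d ρ :=
  let xTilde : Net (Fin m) d := s.x + P.lamK k • (s.xHat - s.xPrev)
  let xLow : Net (Fin m) d := (1 + P.tauK k)⁻¹ • (xTilde + P.tauK k • s.xLow)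
  let y : Net (Fin m) d := WithLp.toLp 2 fun i => gradient (P.ft i) (xLow i)
  let T : ℕ := P.TK R k
  let I : ℕ → Inner m d ρ :=
    P.innerIter R k s.x y { xOld := s.xTail, x := s.x, z := s.z, comms := s.comms }
  { xPrev := s.x
    x := (I T).x
    xTail := (I T).xOld
    xHat := (T : ℝ)⁻¹ • ∑ t ∈ Icc 1 T, (I t).x
    xLow := xLow
    z := (I T).z
    grads := s.grads + 1
    comms := (I T).comms }

/-- The state of the algorithm after `k` outer iterations, started at `x0` and `xl0 = x̲_0`. -/
def run (P : Problem m d ρ) (R : ℝ) (x0 xl0 : Net (Fin m) d) : ℕ → Outer m d ρ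
  | 0 => { xPrev := x0, x := x0, xTail := x0, xHat := x0, xLow := xl0, z := 0,
           grads := 0, comms := 0 }
  | k + 1 => P.outerStep R (k + 1) (run P R x0 xl0 k)

/-- The output `x̄_N` of the algorithm with `N` outer iterations. -/
def output (P : Problem m d ρ) (R : ℝ) (x0 xl0 : Net (Fin m) d) (N : ℕ) : Net (Fin m) d :=
  (∑ k ∈ Icc 1 N, P.betaK k)⁻¹ • ∑ k ∈ Icc 1 N, P.betaK k • (P.run R x0 xl0 k).xHat

/-- The choice `R = (‖z*‖ + 1) / (4 √V(x0, x*))`. -/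
def Rstar (P : Problem m d ρ) (x0 xs : Net (Fin m) d) (zs : Net ρ d) : ℝ :=
  (‖zs‖ + 1) / (4 * √(P.V x0 xs))

end Problem

end PDS

end

/-! The proof is a potential argument. Fix a feasible `w` with `𝒜 w = 0`, a multiplier `z` and an
arbitrary point `v`, and let `gapObj v z x` be the Lagrangian `f(x) + ⟨𝒜 x, z⟩` with `f̃` replaced
by its linearization at `v`. By `outer_progress` and `available_le`, the accumulated weighted gap
plus `potential` never grows after the first outer iteration. As the potential starts from
`L/(4R²)‖z‖² + 4 L V(x₀, w)` and stays nonnegative, `sum_gap_le` bounds the weighted sum of the gaps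
of the `x̂_k`.

Three mechanisms feed the potential. (1) The primal prox-steps satisfy a three-point inequality
(`argmin_spec`), and `η` is chosen so that the prox-distances to `w` telescope. (2) The primal-dual
terms of an inner step are governed by one square, `coupling`. Extrapolation hands it to the next
step (`coupling_step`), and the remaining error `‖𝒜(x_k^t - x_k^{t-1})‖²` is paid by `η V` because
`T_k` is large enough. The weight `β_k / T_k` and the first `α_k^1` make the squares match across
outer iterations too. (3) The recursion for `x̲_k` acts as a prox-step in the dual variable
`∇f̃(x̲_k)`, with Bregman distances of `f̃` as prox-distances (`linearization_identity`). Its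
extrapolation error is absorbed by one such distance and by `p_k V(x_{k-1}, x̂_k)`
(`extrapolation_le`).

The point `v` is free, so it may be the output itself. There `gapObj` is the true Lagrangian, and
Jensen's inequality gives `gap_le`. Taking `z = 0` bounds the objective. Taking `z` of length `‖z*‖
+ 1` along `𝒜 x̄_N`, the saddle inequality costs only `‖z*‖ ‖𝒜 x̄_N‖` and leaves `‖𝒜 x̄_N‖`. The
rate is the inverse of `∑ β_k`, which grows quadratically and, if `μ > 0`, eventually geometrically.
The complexity bounds then follow by summing the `T_k`. -/

noncomputable section

namespace PDS

/-! ### Convex analysis on one block: Bregman distances and prox-steps. -/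

section Block

variable {d : ℕ}

/-- First-order lower bound from a convexity inequality along the segment from `a` to `x`. -/
theorem fderiv_le_of_segment {s : Set (Loc d)} {g : Loc d → ℝ} {g' : Loc d →L[ℝ] ℝ} {a x : Loc d}
    {C : ℝ} (hs : Convex ℝ s) (ha : a ∈ s) (hx : x ∈ s) (hg : HasFDerivWithinAt g g' s a)
    (h : ∀ t : ℝ, 0 ≤ t → t ≤ 1 →
      g (a + t • (x - a)) ≤ (1 - t) * g a + t * g x - t * (1 - t) * C) :
    g' (x - a) ≤ g x - g a - C := by
  have hmaps : Set.MapsTo (fun t : ℝ => a + t • (x - a)) (Set.Icc 0 1) s := by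
    intro t ht
    exact hs.add_smul_sub_mem ha hx ht
  have hline : HasDerivWithinAt (fun t : ℝ => a + t • (x - a)) (x - a) (Set.Icc 0 1) 0 := by
    have h1 := ((hasDerivAt_id (0 : ℝ)).smul_const (x - a)).const_add a
    simpa using h1.hasDerivWithinAt
  have hcomp : HasDerivWithinAt (fun t : ℝ => g (a + t • (x - a))) (g' (x - a))
      (Set.Icc 0 1) 0 := by
    have h0 : HasFDerivWithinAt g g' s ((fun t : ℝ => a + t • (x - a)) 0) := by simpa using hg
    exact h0.comp_hasDerivWithinAt 0 hline hmaps
  have hpoly : HasDerivAt (fun t : ℝ => (1 - t) * g a + t * g x - t * (1 - t) * C)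
      (g x - g a - C) 0 := by
    have h1 := (hasDerivAt_id (0 : ℝ))
    have h2 := h1.const_sub 1
    have h3 := ((h2.mul_const (g a)).add (h1.mul_const (g x))).sub ((h1.mul h2).mul_const C)
    refine h3.congr_deriv ?_
    simp
    ring
  have hdiff := hpoly.hasDerivWithinAt (s := Set.Icc 0 1) |>.sub hcomp
  -- The slack of the convexity inequality is nonnegative on `[0, 1]` and vanishes at `0`, so its
  -- right derivative there is nonnegative.
  have hmin : IsMinOn ((fun t : ℝ => (1 - t) * g a + t * g x - t * (1 - t) * C) -
      fun t : ℝ => g (a + t • (x - a))) (Set.Icc 0 1) 0 := by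
    intro t ht
    have := h t ht.1 ht.2
    simp only [Set.mem_ofPred_eq, Pi.sub_apply]
    simp
    linarith
  have hcone : (1 : ℝ) ∈ posTangentConeAt (Set.Icc (0 : ℝ) 1) 0 := by
    have := sub_mem_posTangentConeAt_of_segment_subset (s := Set.Icc (0 : ℝ) 1) (x := 0) (y := 1)
      (by rw [segment_eq_Icc zero_le_one])
    simpa using this
  have := hmin.localize.hasFDerivWithinAt_nonneg hdiff.hasFDerivWithinAt hcone
  simp at this
  rw [map_sub]
  linarith

theorem seminorm_continuous (p : Seminorm ℝ (Loc d)) : Continuous p := by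
  have := p.convexOn.continuousOn isOpen_univ
  rwa [continuousOn_univ] at this

/-- On a finite-dimensional space a definite seminorm dominates the Euclidean norm. -/
theorem exists_norm_le_mul_seminorm (p : Seminorm ℝ (Loc d)) (hp : ∀ x, p x = 0 → x = 0) :
    ∃ c : ℝ, 0 < c ∧ ∀ x, ‖x‖ ≤ c * p x := by
  by_cases hne : (Metric.sphere (0 : Loc d) 1).Nonempty
  · obtain ⟨u, hu, hmin⟩ := (isCompact_sphere (0 : Loc d) 1).exists_isMinOn hne
      (seminorm_continuous p).continuousOn
    have hu1 : ‖u‖ = 1 := by simpa using hu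
    have hpos : 0 < p u := by
      refine lt_of_le_of_ne (apply_nonneg p u) fun h => ?_
      rw [hp u h.symm] at hu1
      simp at hu1
    refine ⟨(p u)⁻¹, inv_pos.2 hpos, fun x => ?_⟩
    by_cases hx : x = 0
    · simp [hx]
    have hx0 : 0 < ‖x‖ := norm_pos_iff.2 hx
    have hm : p u ≤ p (‖x‖⁻¹ • x) := hmin (by simp [norm_smul, hx0.ne'])
    rw [map_smul_eq_mul, norm_inv, norm_norm] at hm
    rw [inv_mul_eq_div, le_div_iff₀ hpos]
    calc ‖x‖ * p u ≤ ‖x‖ * (‖x‖⁻¹ * p x) := by gcongr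
      _ = p x := by field_simp
  · refine ⟨1, one_pos, fun x => ?_⟩
    by_cases hx : x = 0
    · simp [hx]
    · exact absurd ⟨‖x‖⁻¹ • x, by simp [norm_smul, norm_ne_zero_iff.2 hx]⟩ hne

theorem inner_le_dualNorm_mul (p : Seminorm ℝ (Loc d)) (hp : ∀ x, p x = 0 → x = 0) (y v : Loc d) :
    inner ℝ y v ≤ dualNorm p y * p v := by
  obtain ⟨c, hc, hle⟩ := exists_norm_le_mul_seminorm p hp
  by_cases hv : v = 0
  · simp [hv]
  have hpv : 0 < p v := lt_of_le_of_ne (apply_nonneg p v) fun h => hv (hp v h.symm)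
  have hbdd : BddAbove {r | ∃ v : Loc d, p v ≤ 1 ∧ r = inner ℝ y v} := by
    refine ⟨‖y‖ * c, ?_⟩
    rintro r ⟨w, hw, rfl⟩
    calc inner ℝ y w ≤ ‖y‖ * ‖w‖ := real_inner_le_norm y w
      _ ≤ ‖y‖ * c := by
        gcongr
        exact (hle w).trans (by nlinarith)
  have : inner ℝ y ((p v)⁻¹ • v) ≤ dualNorm p y := by
    refine le_csSup hbdd ⟨(p v)⁻¹ • v, ?_, rfl⟩
    rw [map_smul_eq_mul, norm_inv, Real.norm_of_nonneg hpv.le, inv_mul_cancel₀ hpv.ne']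
  rw [real_inner_smul_right, inv_mul_eq_div, div_le_iff₀ hpv] at this
  exact this

/-- `f` is convex and `L`-smooth with respect to the norm `p`. -/
structure SmoothConvex (p : Seminorm ℝ (Loc d)) (L : ℝ) (f : Loc d → ℝ) : Prop where
  definite : ∀ x, p x = 0 → x = 0
  convex : ConvexOn ℝ Set.univ f
  differentiable : Differentiable ℝ f
  lipschitz : ∀ x y, dualNorm p (gradient f x - gradient f y) ≤ L * p (x - y)

/-- The Bregman distance of a differentiable function. -/
def breg (f : Loc d → ℝ) (u v : Loc d) : ℝ := f u - f v - inner ℝ (gradient f v) (u - v)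

namespace SmoothConvex

variable {p : Seminorm ℝ (Loc d)} {L : ℝ} {f : Loc d → ℝ}

theorem breg_nonneg (h : SmoothConvex p L f) (u v : Loc d) : 0 ≤ breg f u v := by
  have := fderiv_le_of_segment (C := 0) convex_univ (Set.mem_univ v) (Set.mem_univ u)
    (h.differentiable v).hasFDerivAt.hasFDerivWithinAt (fun t h0 h1 => by
      have := h.convex.2 (Set.mem_univ v) (Set.mem_univ u) (sub_nonneg.2 h1) h0 (by ring)
      have e : v + t • (u - v) = (1 - t) • v + t • u := by module
      rw [e]
      simpa using this)
  rw [breg, inner_gradient_left]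
  linarith

/-- Along the segment the derivative of `f` exceeds its initial value by at most `t L p(w)²`, so
subtracting the integrated bound leaves the decreasing function `φ`. -/
theorem breg_le (h : SmoothConvex p L f) (u v : Loc d) : breg f u v ≤ L / 2 * p (u - v) ^ 2 := by
  set w := u - v with hw
  let φ : ℝ → ℝ := fun t => f (v + t • w) - t * inner ℝ (gradient f v) w - t ^ 2 * (L / 2 * p w ^ 2)
  have hder : ∀ t, HasDerivAt φ (inner ℝ (gradient f (v + t • w)) w - inner ℝ (gradient f v) w
      - t * (L * p w ^ 2)) t := by
    intro t
    have h1 : HasDerivAt (fun t : ℝ => v + t • w) w t := by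
      simpa using ((hasDerivAt_id t).smul_const w).const_add v
    have h2 := (h.differentiable (v + t • w)).hasFDerivAt.comp_hasDerivAt t h1
    rw [inner_gradient_left]
    have h3 := (h2.sub ((hasDerivAt_id t).mul_const (inner ℝ (gradient f v) w))).sub
      ((hasDerivAt_pow 2 t).mul_const (L / 2 * p w ^ 2))
    refine h3.congr_deriv ?_
    simp
    ring
  have hanti : AntitoneOn φ (Set.Icc 0 1) := by
    refine antitoneOn_of_deriv_nonpos (convex_Icc 0 1)
      (fun t _ => (hder t).continuousAt.continuousWithinAt)
      (fun t _ => (hder t).differentiableAt.differentiableWithinAt) fun t ht => ?_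
    rw [interior_Icc] at ht
    rw [(hder t).deriv, ← inner_sub_left]
    have h1 := inner_le_dualNorm_mul p h.definite (gradient f (v + t • w) - gradient f v) w
    have h2 := h.lipschitz (v + t • w) v
    have h3 : p (v + t • w - v) = t * p w := by
      rw [add_sub_cancel_left, map_smul_eq_mul, Real.norm_of_nonneg ht.1.le]
    rw [h3] at h2
    nlinarith [apply_nonneg p w]
  have := hanti (by simp) (by simp) (zero_le_one' ℝ)
  simp only [φ] at this
  simp only [one_smul, zero_smul, add_zero] at this
  have e : v + w = u := by simp [hw]
  rw [e] at this
  rw [breg]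
  linarith

/-- Smoothness moves from `u` to `u - s w`, and convexity keeps `f` at that point above its tangent
at `v`. This is the Fenchel-Young form of cocoercivity, and it avoids squaring the dual norm. -/
theorem inner_gradient_sub_le (h : SmoothConvex p L f) (u v w : Loc d) (s : ℝ) :
    s * inner ℝ (gradient f u - gradient f v) w ≤ breg f u v + L / 2 * s ^ 2 * p w ^ 2 := by
  have h1 := h.breg_nonneg (u - s • w) v
  have h2 := h.breg_le (u - s • w) u
  have h3 : p (u - s • w - u) ^ 2 = s ^ 2 * p w ^ 2 := by
    have : u - s • w - u = -(s • w) := by abel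
    rw [this, map_neg_eq_map, map_smul_eq_mul, mul_pow, Real.norm_eq_abs, sq_abs]
  rw [h3] at h2
  simp only [breg, inner_sub_left, inner_sub_right, real_inner_smul_right] at *
  linarith

end SmoothConvex

/-! The prox-function of one block. -/

/-- The Bregman distance of `ν`, differentiated within `X`. -/
def bregWithin (X : Set (Loc d)) (ν : Loc d → ℝ) (a x : Loc d) : ℝ :=
  ν x - ν a - fderivWithin ℝ ν X a (x - a)

/-- Closed convex set with a differentiable function that is strongly convex on it. -/
structure ProxSetup (p : Seminorm ℝ (Loc d)) (X : Set (Loc d)) (ν : Loc d → ℝ) : Prop where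
  definite : ∀ x, p x = 0 → x = 0
  closed : IsClosed X
  differentiable : DifferentiableOn ℝ ν X
  strong : StronglyConvexOn p X ν

namespace ProxSetup

variable {p : Seminorm ℝ (Loc d)} {X : Set (Loc d)} {ν : Loc d → ℝ}

/-- Only the derivative along the segment from `a` to `x` enters, so the choice made by
`fderivWithin` when `X` has empty interior is harmless. -/
theorem half_sq_le_breg (h : ProxSetup p X ν) {a x : Loc d} (ha : a ∈ X) (hx : x ∈ X) :
    1 / 2 * p (x - a) ^ 2 ≤ bregWithin X ν a x := by
  have := fderiv_le_of_segment (C := 1 / 2 * p (x - a) ^ 2) h.strong.1 ha hx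
    (h.differentiable a ha).hasFDerivWithinAt (fun t h0 h1 => by
      have := h.strong.2 a ha x hx (1 - t) t (sub_nonneg.2 h1) h0 (by ring)
      have e : a + t • (x - a) = (1 - t) • a + t • x := by module
      rw [e]
      rw [map_sub_rev p a x] at this
      linarith)
  rw [bregWithin]
  linarith

theorem breg_nonneg (h : ProxSetup p X ν) {a x : Loc d} (ha : a ∈ X) (hx : x ∈ X) :
    0 ≤ bregWithin X ν a x :=
  (by positivity : (0 : ℝ) ≤ 1 / 2 * p (x - a) ^ 2).trans (h.half_sq_le_breg ha hx)

/-- Coercivity: relative to its value at `a`, the objective is at least `σ/2 · p(w - a)² - ‖l'‖ ‖w -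
a‖`, and `p` dominates the Euclidean norm. The threshold `2 c² ‖l'‖ / σ` is where the quadratic term
takes over. -/
theorem exists_isMinOn (h : ProxSetup p X ν) (hne : X.Nonempty) {σ : ℝ} (hσ : 0 < σ)
    (l : Loc d →L[ℝ] ℝ) : ∃ x ∈ X, IsMinOn (fun w => σ * ν w + l w) X x := by
  obtain ⟨a, ha⟩ := hne
  obtain ⟨c, hc, hle⟩ := exists_norm_le_mul_seminorm p h.definite
  set l' : Loc d →L[ℝ] ℝ := σ • fderivWithin ℝ ν X a + l with hl'
  have hcont : ContinuousOn (fun w => σ * ν w + l w) X :=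
    (continuousOn_const.mul h.differentiable.continuousOn).add l.continuous.continuousOn
  refine hcont.exists_isMinOn' h.closed ha ?_
  rw [Filter.eventually_inf_principal]
  have hev : ∀ᶠ w in Filter.cocompact (Loc d), 2 * c ^ 2 * ‖l'‖ / σ ≤ ‖w - a‖ := by
    have h1 : Filter.Tendsto (fun w : Loc d => ‖w - a‖) (Filter.cocompact (Loc d))
        Filter.atTop := by
      have := tendsto_dist_right_cocompact_atTop (α := Loc d) a
      simpa [dist_eq_norm] using this
    exact h1.eventually_ge_atTop _
  filter_upwards [hev] with w hw hwX
  have h1 := h.half_sq_le_breg ha hwX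
  rw [bregWithin] at h1
  have h2 : -(‖l'‖ * ‖w - a‖) ≤ l' (w - a) := by
    have := l'.le_opNorm (w - a)
    rw [Real.norm_eq_abs] at this
    exact (abs_le.1 this).1
  have h3 := hle (w - a)
  have h4 : l' (w - a) = σ * fderivWithin ℝ ν X a (w - a) + (l w - l a) := by
    simp [hl']
  have h5 : ‖w - a‖ ^ 2 ≤ c ^ 2 * p (w - a) ^ 2 := by
    rw [← mul_pow]
    gcongr
  rw [div_le_iff₀ hσ] at hw
  have h6 : ‖l'‖ * ‖w - a‖ ≤ σ * (1 / 2 * p (w - a) ^ 2) := by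
    have h7 : c ^ 2 * (‖l'‖ * ‖w - a‖) ≤ c ^ 2 * (σ * (1 / 2 * p (w - a) ^ 2)) := by
      nlinarith [norm_nonneg (w - a)]
    exact le_of_mul_le_mul_left h7 (by positivity)
  have h8 := mul_le_mul_of_nonneg_left h1 hσ.le
  nlinarith

/-- The prox-step: the minimizer is feasible and satisfies the three-point inequality. -/
theorem argmin_spec (h : ProxSetup p X ν) {a b : Loc d} (ha : a ∈ X) {μ η q : ℝ}
    (hσ : 0 < μ + η + q) (y : Loc d) :
    argmin X (fun w => μ * ν w + inner ℝ y w + η * bregWithin X ν a w + q * bregWithin X ν b w) ∈ X ∧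
    ∀ w ∈ X, ∀ x, x = argmin X (fun w => μ * ν w + inner ℝ y w + η * bregWithin X ν a w
        + q * bregWithin X ν b w) →
      μ * ν x + inner ℝ y x + η * bregWithin X ν a x + q * bregWithin X ν b x
        + (μ + η + q) * bregWithin X ν x w ≤
      μ * ν w + inner ℝ y w + η * bregWithin X ν a w + q * bregWithin X ν b w := by
  set φ : Loc d → ℝ := fun w => μ * ν w + inner ℝ y w + η * bregWithin X ν a w
    + q * bregWithin X ν b w with hφ
  set σ := μ + η + q
  set l : Loc d →L[ℝ] ℝ := innerSL ℝ y - η • fderivWithin ℝ ν X a - q • fderivWithin ℝ ν X b with hl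
  -- Each Bregman distance is `ν` plus an affine function, so the whole objective is `σ ν` plus an
  -- affine function. Its excess over the minimum then contains the Bregman distance with weight
  -- exactly `σ`.
  have hφl : ∀ w, φ w = σ * ν w + l w + (η * (fderivWithin ℝ ν X a a - ν a)
      + q * (fderivWithin ℝ ν X b b - ν b)) := by
    intro w
    simp only [hφ, hl, bregWithin, σ, map_sub]
    simp
    ring
  obtain ⟨x₀, hx₀, hmin₀⟩ := h.exists_isMinOn ⟨a, ha⟩ hσ l
  have hex : ∃ x, x ∈ X ∧ IsMinOn φ X x := by
    refine ⟨x₀, hx₀, fun w hw => ?_⟩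
    have := hmin₀ hw
    simp only [Set.mem_ofPred_eq] at this ⊢
    rw [hφl, hφl]
    linarith
  have hspec : argmin X φ ∈ X ∧ IsMinOn φ X (argmin X φ) := Classical.epsilon_spec hex
  refine ⟨hspec.1, fun w hw x hx => ?_⟩
  rw [← hx] at hspec
  obtain ⟨hxX, hmin⟩ := hspec
  have hmin' : IsMinOn (fun w => σ * ν w + l w) X x := by
    intro v hv
    have := hmin hv
    simp only [Set.mem_ofPred_eq] at this ⊢
    rw [hφl, hφl] at this
    linarith
  have hd : HasFDerivWithinAt (fun w => σ * ν w + l w) (σ • fderivWithin ℝ ν X x + l) X x :=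
    ((h.differentiable x hxX).hasFDerivWithinAt.const_mul σ).add l.hasFDerivWithinAt
  have h1 := hmin'.localize.hasFDerivWithinAt_nonneg hd
    (sub_mem_posTangentConeAt_of_segment_subset (h.strong.1.segment_subset hxX hw))
  have h2 : l (w - x) = l w - l x := map_sub l w x
  have h3 : φ x + σ * bregWithin X ν x w ≤ φ w := by
    rw [hφl, hφl, bregWithin]
    simp only [add_apply, smul_apply, smul_eq_mul] at h1
    linarith
  exact h3

end ProxSetup

/-- The dual step has an explicit solution. -/
theorem argmin_quadratic (c z : Loc d) {q : ℝ} (hq : 0 < q) :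
    argmin Set.univ (fun w => inner ℝ c w + q / 2 * ‖w - z‖ ^ 2) = z - q⁻¹ • c := by
  set φ : Loc d → ℝ := fun w => inner ℝ c w + q / 2 * ‖w - z‖ ^ 2 with hφ
  set x := z - q⁻¹ • c with hx
  have key : ∀ w, φ w = φ x + q / 2 * ‖w - x‖ ^ 2 := by
    intro w
    have e1 : w - z = (w - x) - q⁻¹ • c := by rw [hx]; abel
    have e2 : x - z = -(q⁻¹ • c) := by rw [hx]; abel
    have e3 : w = (w - x) + x := by abel
    have e4 : inner ℝ c w = inner ℝ c (w - x) + inner ℝ c x := by rw [← inner_add_right, ← e3]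
    simp only [hφ]
    rw [e4, e1, e2, norm_neg, norm_sub_sq_real, real_inner_smul_right, real_inner_comm]
    field_simp
    ring
  have hex : ∃ x, x ∈ Set.univ ∧ IsMinOn φ Set.univ x := by
    refine ⟨x, Set.mem_univ _, fun w _ => ?_⟩
    simp only [Set.mem_ofPred_eq]
    rw [key w]
    have : 0 ≤ q / 2 * ‖w - x‖ ^ 2 := by positivity
    linarith
  have hspec : argmin Set.univ φ ∈ Set.univ ∧ IsMinOn φ Set.univ (argmin Set.univ φ) :=
    Classical.epsilon_spec hex
  have h1 := hspec.2 (Set.mem_univ x)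
  simp only [Set.mem_ofPred_eq] at h1
  rw [key (argmin Set.univ φ)] at h1
  have h2 : ‖argmin Set.univ φ - x‖ ^ 2 ≤ 0 := by
    by_contra hcon
    push Not at hcon
    have : 0 < q / 2 * ‖argmin Set.univ φ - x‖ ^ 2 := by positivity
    linarith
  have h3 : ‖argmin Set.univ φ - x‖ = 0 := by
    have := sq_nonneg ‖argmin Set.univ φ - x‖
    exact pow_eq_zero_iff (two_ne_zero) |>.1 (le_antisymm h2 this)
  exact sub_eq_zero.1 (norm_eq_zero.1 h3)

end Block

namespace Problem

/-! ### The step-size parameters: growth of the weights and the inequalities behind the telescoping.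
-/

section Parameters

variable {m d : ℕ} {ρ : Type} {P : Problem m d ρ}

theorem tau_nonneg (P : Problem m d ρ) : 0 ≤ P.tau := Real.sqrt_nonneg _

theorem tau_pos (hμ : 0 < P.μ) (hL : 0 < P.L) : 0 < P.tau := Real.sqrt_pos.2 (by positivity)

theorem mu_mul_tau_sq (hμ : 0 < P.μ) (hL : 0 < P.L) : P.μ * P.tau ^ 2 = 2 * P.L := by
  rw [tau, Real.sq_sqrt (by positivity)]
  field_simp

theorem le_Delta (P : Problem m d ρ) : 2 * P.tau + 1 ≤ P.Delta := Nat.le_ceil _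

theorem Delta_le (P : Problem m d ρ) : (P.Delta : ℝ) ≤ 2 * P.tau + 2 := by
  have := Nat.ceil_lt_add_one (a := 2 * P.tau + 1) (by linarith [P.tau_nonneg])
  rw [Delta]
  linarith

theorem one_le_Delta (P : Problem m d ρ) : 1 ≤ P.Delta := by
  have := P.le_Delta
  have h := P.tau_nonneg
  exact_mod_cast (by linarith : (1 : ℝ) ≤ P.Delta)

theorem lam_pos (hμ : 0 < P.μ) (hL : 0 < P.L) : 0 < P.lam := by
  have := tau_pos hμ hL
  rw [lam]
  positivity

theorem lam_lt_one (P : Problem m d ρ) : P.lam < 1 := by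
  have := P.tau_nonneg
  rw [lam, div_lt_one (by linarith)]
  linarith

theorem lam_mul (P : Problem m d ρ) : P.lam * (1 + P.tau) = P.tau := by
  have := P.tau_nonneg
  rw [lam, div_mul_cancel₀ _ (by linarith)]

theorem early_one (P : Problem m d ρ) : P.early 1 := Or.inr P.one_le_Delta

theorem not_early_iff {k : ℕ} (hμ : 0 ≤ P.μ) : ¬ P.early k ↔ 0 < P.μ ∧ P.Delta < k := by
  rw [early, not_or, not_le]
  exact ⟨fun h => ⟨lt_of_le_of_ne hμ (Ne.symm h.1), h.2⟩, fun h => ⟨h.1.ne', h.2⟩⟩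

theorem not_early_add {n : ℕ} (hμ : 0 < P.μ) : ¬ P.early (P.Delta + (n + 1)) :=
  (not_early_iff hμ.le).2 ⟨hμ, by omega⟩

theorem not_early_add_succ (n : ℕ) (hμ : 0 < P.μ) : ¬ P.early (P.Delta + (n + 1) + 1) :=
  not_early_add (n := n + 1) hμ

theorem betaK_early {k : ℕ} (h : P.early k) : P.betaK k = k := if_pos h
theorem tauK_early {k : ℕ} (h : P.early k) : P.tauK k = ((k : ℝ) - 1) / 2 := if_pos h
theorem lamK_early {k : ℕ} (h : P.early k) : P.lamK k = ((k : ℝ) - 1) / k := if_pos h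
theorem pK_early {k : ℕ} (h : P.early k) : P.pK k = 2 * P.L / k := if_pos h
theorem tauK_late {k : ℕ} (h : ¬ P.early k) : P.tauK k = P.tau := if_neg h
theorem lamK_late {k : ℕ} (h : ¬ P.early k) : P.lamK k = P.lam := if_neg h
theorem pK_late {k : ℕ} (h : ¬ P.early k) : P.pK k = P.L / (1 + P.tau) := if_neg h

/-- The case `n = 0` is still early, but both formulas give `Δ` there, so the two phases join. -/
theorem betaK_late (n : ℕ) (hμ : 0 < P.μ) (hL : 0 < P.L) :
    P.betaK (P.Delta + n) = P.Delta * (P.lam ^ n)⁻¹ := by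
  have hl := lam_pos hμ hL
  cases n with
  | zero => rw [betaK_early (Or.inr (by omega))]; simp
  | succ n =>
    rw [betaK, if_neg (not_early_add hμ)]
    congr 1
    rw [← Real.rpow_natCast, ← Real.rpow_neg hl.le]
    congr 1
    push_cast
    ring

/-- Two consecutive iterations lie both in the early phase, or in the late one, the first of them
possibly being the last early one. -/
theorem early_cases (hμ : 0 ≤ P.μ) (k : ℕ) :
    (P.early k ∧ P.early (k + 1)) ∨ (0 < P.μ ∧ k = P.Delta) ∨
      (0 < P.μ ∧ ∃ n, k = P.Delta + (n + 1)) := by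
  by_cases h : P.early (k + 1)
  · refine Or.inl ⟨?_, h⟩
    rcases h with h | h
    · exact Or.inl h
    · exact Or.inr (by omega)
  · obtain ⟨h1, h2⟩ := (not_early_iff hμ).1 h
    rcases (Nat.lt_succ_iff.1 h2).eq_or_lt with h3 | h3
    · exact Or.inr (Or.inl ⟨h1, h3.symm⟩)
    · exact Or.inr (Or.inr ⟨h1, k - P.Delta - 1, by omega⟩)

theorem early_or (hμ : 0 ≤ P.μ) (k : ℕ) :
    P.early k ∨ (0 < P.μ ∧ ∃ n, k = P.Delta + (n + 1)) := by
  by_cases h : P.early k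
  · exact Or.inl h
  · obtain ⟨h1, h2⟩ := (not_early_iff hμ).1 h
    exact Or.inr ⟨h1, k - P.Delta - 1, by omega⟩

theorem le_betaK (hμ : 0 ≤ P.μ) (hL : 0 < P.L) (k : ℕ) : (k : ℝ) ≤ P.betaK k := by
  rcases early_or hμ k with h | ⟨h, n, rfl⟩
  · rw [betaK_early h]
  · have hl := lam_pos h hL
    have hτ := tau_pos h hL
    have hΔ := P.le_Delta
    rw [betaK_late _ h hL, ← inv_pow]
    have hb : P.lam⁻¹ = 1 + P.tau⁻¹ := by
      rw [lam]
      field_simp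
      ring
    -- Bernoulli with `λ⁻¹ = 1 + τ⁻¹`. Since `Δ ≥ τ`, each late step adds at least `1` to the lower
    -- bound.
    have hber := one_add_mul_le_pow (a := P.tau⁻¹) (by linarith [inv_pos.2 hτ]) (n + 1)
    rw [← hb] at hber
    calc ((P.Delta + (n + 1) : ℕ) : ℝ) = P.Delta + ((n + 1 : ℕ) : ℝ) * 1 := by push_cast; ring
      _ ≤ P.Delta + ((n + 1 : ℕ) : ℝ) * (P.Delta * P.tau⁻¹) := by
        gcongr
        rw [← div_eq_mul_inv, le_div_iff₀ hτ]
        linarith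
      _ = P.Delta * (1 + ((n + 1 : ℕ) : ℝ) * P.tau⁻¹) := by ring
      _ ≤ _ := by gcongr

theorem betaK_pos (hμ : 0 ≤ P.μ) (hL : 0 < P.L) {k : ℕ} (hk : 1 ≤ k) : 0 < P.betaK k :=
  lt_of_lt_of_le (by exact_mod_cast hk) (le_betaK hμ hL k)

theorem pK_pos (hL : 0 < P.L) {k : ℕ} (hk : 1 ≤ k) : 0 < P.pK k := by
  have hτ := P.tau_nonneg
  have hk' : (0 : ℝ) < k := by exact_mod_cast hk
  rw [pK]
  split_ifs <;> positivity

theorem tauK_nonneg {k : ℕ} (hk : 1 ≤ k) : 0 ≤ P.tauK k := by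
  have hk' : (1 : ℝ) ≤ k := by exact_mod_cast hk
  rw [tauK]
  split_ifs
  · linarith
  · exact P.tau_nonneg

theorem tauK_succ_pos (hμ : 0 ≤ P.μ) (hL : 0 < P.L) {k : ℕ} (hk : 1 ≤ k) :
    0 < P.tauK (k + 1) := by
  have hk' : (1 : ℝ) ≤ k := by exact_mod_cast hk
  by_cases h : P.early (k + 1)
  · rw [tauK_early h]
    push_cast
    linarith
  · rw [tauK_late h]
    exact tau_pos ((not_early_iff hμ).1 h).1 hL

/-- Makes the extrapolation terms telescope with equality. -/
theorem betaK_mul_lamK (hμ : 0 ≤ P.μ) (hL : 0 < P.L) (k : ℕ) :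
    P.betaK (k + 1) * P.lamK (k + 1) = P.betaK k := by
  rcases early_cases hμ k with ⟨h1, h2⟩ | ⟨h, rfl⟩ | ⟨h, n, rfl⟩
  · rw [betaK_early h1, betaK_early h2, lamK_early h2]
    push_cast
    field_simp
    ring
  · have hl := lam_pos h hL
    rw [lamK_late (not_early_add (n := 0) h), betaK_late 1 h hL, betaK_early (Or.inr le_rfl)]
    field_simp
  · have hl := lam_pos h hL
    rw [lamK_late (not_early_add_succ n h), betaK_late (n + 1) h hL, add_assoc,
      betaK_late (n + 1 + 1) h hL, pow_succ _ (n + 1)]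
    field_simp

/-- Lets the Bregman distances of `f̃` telescope. At the change of phase it amounts to `Δ ≥ 2τ + 1`,
the lower bound built into `Δ`. -/
theorem betaK_mul_tauK_le (hμ : 0 ≤ P.μ) (hL : 0 < P.L) (k : ℕ) :
    P.betaK (k + 1) * P.tauK (k + 1) ≤ P.betaK k * (1 + P.tauK k) := by
  have hΔ := P.le_Delta
  have hm := P.lam_mul
  have hβ := betaK_mul_lamK hμ hL k
  rcases early_cases hμ k with ⟨h1, h2⟩ | ⟨h, rfl⟩ | ⟨h, n, rfl⟩
  · rw [betaK_early h1, betaK_early h2, tauK_early h1, tauK_early h2]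
    push_cast
    nlinarith
  · rw [lamK_late (not_early_add (n := 0) h)] at hβ
    rw [tauK_late (not_early_add (n := 0) h)]
    nth_rw 1 [← hm]
    rw [← mul_assoc, hβ, tauK_early (Or.inr le_rfl), betaK_early (Or.inr le_rfl)]
    gcongr
    linarith
  · rw [lamK_late (not_early_add_succ n h)] at hβ
    rw [tauK_late (not_early_add_succ n h), tauK_late (not_early_add (n := n) h)]
    nth_rw 1 [← hm]
    rw [← mul_assoc, hβ]

/-- Lets the prox-distances telescope across outer iterations: the factor `2` counts the shares of
`η` and of `p`, and `μ` is the gain from strong convexity. At the change of phase it reduces to `Δ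
(τ - 1) ≤ 2 τ²`, which follows from `Δ ≤ 2τ + 2`. -/
theorem two_betaK_mul_pK_le (hμ : 0 ≤ P.μ) (hL : 0 < P.L) {k : ℕ} (hk : 1 ≤ k) :
    2 * P.betaK (k + 1) * P.pK (k + 1) ≤ P.betaK k * (2 * P.pK k + P.μ) := by
  have hΔ := P.le_Delta
  have hΔ' := P.Delta_le
  have hm := P.lam_mul
  have hβ := betaK_mul_lamK hμ hL k
  have hk' : (0 : ℝ) < k := by exact_mod_cast hk
  rcases early_cases hμ k with ⟨h1, h2⟩ | ⟨h, rfl⟩ | ⟨h, n, rfl⟩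
  · rw [betaK_early h1, betaK_early h2, pK_early h1, pK_early h2]
    have e1 : 2 * ((k + 1 : ℕ) : ℝ) * (2 * P.L / ((k + 1 : ℕ) : ℝ)) = 4 * P.L := by
      field_simp
      ring
    have e2 : (k : ℝ) * (2 * (2 * P.L / k) + P.μ) = 4 * P.L + k * P.μ := by
      field_simp
      ring
    rw [e1, e2]
    nlinarith
  · have hτ := tau_pos h hL
    have hsq := mu_mul_tau_sq h hL
    rw [lamK_late (not_early_add (n := 0) h)] at hβ
    rw [pK_late (not_early_add (n := 0) h), pK_early (Or.inr le_rfl)]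
    rw [betaK_early (Or.inr le_rfl)] at hβ ⊢
    have e1 : 2 * P.betaK (P.Delta + 1) * (P.L / (1 + P.tau)) = P.μ * P.tau * P.Delta := by
      rw [← hβ, mul_div_assoc', div_eq_iff (by positivity)]
      have : P.μ * P.tau * (P.betaK (P.Delta + 1) * P.lam) * (1 + P.tau) =
        P.μ * P.tau * P.betaK (P.Delta + 1) * (P.lam * (1 + P.tau)) := by ring
      rw [this, hm]
      linear_combination (-P.betaK (P.Delta + 1)) * hsq
    have e2 : (P.Delta : ℝ) * (2 * (2 * P.L / P.Delta) + P.μ) =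
        2 * (P.μ * P.tau ^ 2) + P.Delta * P.μ := by
      rw [hsq]
      field_simp
    rw [e1, e2]
    have : P.Delta * (P.tau - 1) ≤ 2 * P.tau ^ 2 := by
      rcases le_total 1 P.tau with h1 | h1
      · nlinarith
      · nlinarith
    nlinarith
  · have hτ := tau_pos h hL
    have hsq := mu_mul_tau_sq h hL
    have hβp := betaK_pos hμ hL (k := P.Delta + (n + 1) + 1) (by omega)
    rw [lamK_late (not_early_add_succ n h)] at hβ
    rw [pK_late (not_early_add_succ n h), pK_late (not_early_add (n := n) h), ← hβ]
    have key : 2 * (P.L / (1 + P.tau)) ≤ P.lam * (2 * (P.L / (1 + P.tau)) + P.μ) := by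
      have e3 : P.lam * (2 * (P.L / (1 + P.tau)) + P.μ) - 2 * (P.L / (1 + P.tau)) =
          P.lam * P.μ - (1 - P.lam) * (P.μ * P.tau ^ 2 / (1 + P.tau)) := by
        rw [hsq]
        ring
      have e4 : P.lam * P.μ - (1 - P.lam) * (P.μ * P.tau ^ 2 / (1 + P.tau)) =
          P.μ * P.tau / (1 + P.tau) ^ 2 := by
        rw [lam]
        field_simp
        ring
      have : 0 ≤ P.μ * P.tau / (1 + P.tau) ^ 2 := by positivity
      linarith
    nlinarith [mul_le_mul_of_nonneg_left key hβp.le]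

/-- The budget for the gradient extrapolation error. It is an equality in the late phase, and at the
change of phase it is again `Δ ≤ 2τ + 2`. -/
theorem L_mul_lamK_le (hμ : 0 ≤ P.μ) (hL : 0 < P.L) {k : ℕ} (hk : 1 ≤ k) :
    P.L * P.lamK (k + 1) ≤ P.pK k * P.tauK (k + 1) := by
  have hΔ' := P.Delta_le
  have hk' : (0 : ℝ) < k := by exact_mod_cast hk
  rcases early_cases hμ k with ⟨h1, h2⟩ | ⟨h, rfl⟩ | ⟨h, n, rfl⟩
  · rw [lamK_early h2, tauK_early h2, pK_early h1]
    push_cast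
    have : 2 * P.L / k * ((k + 1 - 1) / 2) = P.L := by field_simp; ring
    rw [this]
    have : ((k : ℝ) + 1 - 1) / (k + 1) ≤ 1 := by
      rw [div_le_one (by positivity)]
      linarith
    nlinarith
  · have hτ := tau_pos h hL
    rw [lamK_late (not_early_add (n := 0) h), tauK_late (not_early_add (n := 0) h),
      pK_early (Or.inr le_rfl), lam, mul_div_assoc', div_mul_eq_mul_div]
    rw [div_le_div_iff₀ (by positivity) hk']
    nlinarith [mul_pos hL hτ]
  · have hτ := tau_pos h hL
    rw [lamK_late (not_early_add_succ n h), tauK_late (not_early_add_succ n h),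
      pK_late (not_early_add (n := n) h), lam]
    apply le_of_eq
    ring

/-- Needed only for the last iteration, where the potential left over must be nonnegative. -/
theorem L_le_pK_mul (hμ : 0 ≤ P.μ) (hL : 0 < P.L) {k : ℕ} (hk : 1 ≤ k) :
    P.L ≤ P.pK k * (1 + P.tauK k) := by
  have hk' : (0 : ℝ) < k := by exact_mod_cast hk
  rcases early_or hμ k with h | ⟨h, n, rfl⟩
  · rw [pK_early h, tauK_early h, div_mul_eq_mul_div, le_div_iff₀ hk']
    nlinarith
  · have hτ := tau_pos h hL
    rw [pK_late (not_early_add h), tauK_late (not_early_add h)]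
    apply le_of_eq
    field_simp

theorem tauK_one (P : Problem m d ρ) : P.tauK 1 = 0 := by rw [tauK_early P.early_one]; simp
theorem betaK_one (P : Problem m d ρ) : P.betaK 1 = 1 := by rw [betaK_early P.early_one]; simp
theorem pK_one (P : Problem m d ρ) : P.pK 1 = 2 * P.L := by rw [pK_early P.early_one]; simp

theorem sum_betaK_ge (hμ : 0 ≤ P.μ) (hL : 0 < P.L) (N : ℕ) :
    (N : ℝ) * (N + 1) / 2 ≤ ∑ k ∈ Icc 1 N, P.betaK k := by
  induction N with
  | zero => simp
  | succ N ih =>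
    rw [sum_Icc_succ_top (by omega)]
    have := le_betaK hμ hL (N + 1)
    push_cast at this ⊢
    linarith

theorem sum_betaK_pos (hμ : 0 ≤ P.μ) (hL : 0 < P.L) {N : ℕ} (hN : 1 ≤ N) :
    0 < ∑ k ∈ Icc 1 N, P.betaK k := by
  have hN' : (0 : ℝ) < N := by exact_mod_cast hN
  exact lt_of_lt_of_le (by positivity) (sum_betaK_ge hμ hL N)

theorem inv_sum_betaK_le_rate (hμ : 0 ≤ P.μ) (hL : 0 < P.L) {N : ℕ} (hN : 1 ≤ N) :
    (∑ k ∈ Icc 1 N, P.betaK k)⁻¹ ≤ P.rate N := by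
  have hN' : (1 : ℝ) ≤ N := by exact_mod_cast hN
  have hge := sum_betaK_ge hμ hL N
  have h1 : (∑ k ∈ Icc 1 N, P.betaK k)⁻¹ ≤ 2 / (N : ℝ) ^ 2 := by
    rw [← inv_div]
    apply inv_anti₀ (by positivity)
    nlinarith
  rw [rate]
  split_ifs with h
  · exact h1
  refine le_min h1 ?_
  have hμ' : 0 < P.μ := lt_of_le_of_ne hμ (Ne.symm h)
  have hl := lam_pos hμ' hL
  -- For `N ≤ Δ` the geometric bound is at least `1` and hence trivial. For larger `N` the last
  -- weight alone suffices.
  rcases le_total N P.Delta with hD | hD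
  · have h2 : (1 : ℝ) ≤ P.lam ^ ((N : ℝ) - P.Delta) :=
      Real.one_le_rpow_of_pos_of_le_one_of_nonpos hl P.lam_lt_one.le
        (sub_nonpos.2 (by exact_mod_cast hD))
    refine le_trans (inv_le_one_of_one_le₀ ?_) h2
    nlinarith
  · obtain ⟨n, rfl⟩ := Nat.exists_eq_add_of_le hD
    have h3 : P.betaK (P.Delta + n) ≤ ∑ k ∈ Icc 1 (P.Delta + n), P.betaK k :=
      single_le_sum (f := P.betaK) (fun k hk => (betaK_pos hμ hL (mem_Icc.1 hk).1).le)
        (mem_Icc.2 ⟨hN, le_rfl⟩)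
    rw [betaK_late n hμ' hL] at h3
    have e : P.lam ^ (((P.Delta + n : ℕ) : ℝ) - P.Delta) = P.lam ^ n := by
      rw [← Real.rpow_natCast]
      congr 1
      push_cast
      ring
    rw [e]
    refine inv_le_of_inv_le₀ (by positivity) (le_trans ?_ h3)
    have : (1 : ℝ) ≤ P.Delta := by exact_mod_cast P.one_le_Delta
    exact le_mul_of_one_le_left (by positivity) this

theorem betaK_zero (P : Problem m d ρ) : P.betaK 0 = 0 := by
  rw [betaK_early (Or.inr (Nat.zero_le _)), Nat.cast_zero]

theorem rate_pos (hμ : 0 ≤ P.μ) (hL : 0 < P.L) {N : ℕ} (hN : 1 ≤ N) : 0 < P.rate N :=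
  (inv_pos.2 (sum_betaK_pos hμ hL hN)).trans_le (inv_sum_betaK_le_rate hμ hL hN)

variable [Fintype ρ] {R : ℝ}

theorem TK_early {k : ℕ} (h : P.early k) : P.TK R k = ⌈k * R * P.opNorm / P.L⌉₊ := if_pos h

theorem TK_late (n : ℕ) (h : 0 < P.μ) :
    P.TK R (P.Delta + (n + 1)) =
      ⌈2 * (1 + P.tau) * R * P.opNorm / (P.L * √P.lam ^ (n + 1))⌉₊ := by
  rw [TK, if_neg (not_early_add h)]
  have : P.lam ^ ((((P.Delta + (n + 1) : ℕ) : ℝ) - P.Delta) / 2) = √P.lam ^ (n + 1) := by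
    rw [Real.sqrt_eq_rpow, ← Real.rpow_natCast, ← Real.rpow_mul (by
      have := P.tau_nonneg
      rw [lam]
      positivity)]
    congr 1
    push_cast
    ring
  rw [this]

theorem TK_pos (hμ : 0 ≤ P.μ) (hL : 0 < P.L) (hR : 0 < R) (hA : 0 < P.opNorm) {k : ℕ}
    (hk : 1 ≤ k) : 0 < P.TK R k := by
  have hk' : (0 : ℝ) < k := by exact_mod_cast hk
  rcases early_or hμ k with h | ⟨h, n, rfl⟩
  · rw [TK_early h, Nat.ceil_pos]
    positivity
  · have hτ := tau_pos h hL
    have hl := lam_pos h hL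
    rw [TK_late n h, Nat.ceil_pos]
    positivity

/-- The numbers of inner iterations are large enough for the primal-dual coupling. -/
theorem two_betaK_mul_opNorm_sq_le (hμ : 0 ≤ P.μ) (hL : 0 < P.L) (hR : 0 < R)
    (hA : 0 < P.opNorm) {k : ℕ} (hk : 1 ≤ k) :
    2 * P.betaK k * P.opNorm ^ 2 * R ^ 2 ≤ P.L * P.pK k * (P.TK R k : ℝ) ^ 2 := by
  have hk' : (0 : ℝ) < k := by exact_mod_cast hk
  rcases early_or hμ k with h | ⟨h, n, rfl⟩
  · have hT : k * R * P.opNorm / P.L ≤ P.TK R k := by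
      rw [TK_early h]
      exact Nat.le_ceil _
    rw [betaK_early h, pK_early h]
    calc 2 * (k : ℝ) * P.opNorm ^ 2 * R ^ 2
        = P.L * (2 * P.L / k) * (k * R * P.opNorm / P.L) ^ 2 := by field_simp
      _ ≤ _ := by gcongr
  · have hτ := tau_pos h hL
    have hl := lam_pos h hL
    have hΔ := P.Delta_le
    have hT : 2 * (1 + P.tau) * R * P.opNorm / (P.L * √P.lam ^ (n + 1)) ≤
        P.TK R (P.Delta + (n + 1)) := by
      rw [TK_late n h]
      exact Nat.le_ceil _
    rw [betaK_late _ h hL, pK_late (not_early_add h)]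
    have hs : (√P.lam ^ (n + 1)) ^ 2 = P.lam ^ (n + 1) := by
      rw [← pow_mul, mul_comm, pow_mul, Real.sq_sqrt hl.le]
    -- Squaring `T_k` turns its `λ^{1/2}` into the `λ` of `β_k`, and the factor `2(1 + τ)` in `T_k`
    -- is there to dominate `Δ`.
    calc 2 * (P.Delta * (P.lam ^ (n + 1))⁻¹) * P.opNorm ^ 2 * R ^ 2
        ≤ 2 * ((2 * (1 + P.tau)) * (P.lam ^ (n + 1))⁻¹) * P.opNorm ^ 2 * R ^ 2 := by
          gcongr
          linarith
      _ = P.L * (P.L / (1 + P.tau)) *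
          (2 * (1 + P.tau) * R * P.opNorm / (P.L * √P.lam ^ (n + 1))) ^ 2 := by
          rw [div_pow, mul_pow P.L, hs]
          field_simp
      _ ≤ _ := by gcongr

end Parameters

/-! ### The networked operator, the primal-dual coupling and the inner loop. -/

section Network

variable {m d : ℕ} {ρ : Type} {P : Problem m d ρ}

theorem Assumptions.smooth (h : P.Assumptions) (i : Fin m) : SmoothConvex P.p P.L (P.ft i) :=
  ⟨h.p_definite, h.ft_convex i, h.ft_differentiable i, h.ft_lipschitz i⟩

theorem Assumptions.prox (h : P.Assumptions) (i : Fin m) : ProxSetup P.p (P.X i) (P.ν i) :=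
  ⟨h.p_definite, h.X_closed i, h.nu_differentiable i, h.nu_strongly_convex i⟩

/-- `𝒜` as a linear map. -/
def AL (P : Problem m d ρ) : Net (Fin m) d →ₗ[ℝ] Net ρ d where
  toFun := P.A
  map_add' x y := by
    ext1 r
    simp [A, smul_add, sum_add_distrib]
  map_smul' c x := by
    ext1 r
    simp [A, smul_sum, smul_comm c]

theorem A_eq (x : Net (Fin m) d) : P.A x = P.AL x := rfl

theorem netNorm_nonneg (x : Net (Fin m) d) : 0 ≤ P.netNorm x := Real.sqrt_nonneg _

theorem netNorm_sq (x : Net (Fin m) d) : P.netNorm x ^ 2 = ∑ i, P.p (x i) ^ 2 :=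
  Real.sq_sqrt (sum_nonneg fun _ _ => sq_nonneg _)

theorem netNorm_smul (c : ℝ) (x : Net (Fin m) d) : P.netNorm (c • x) = |c| * P.netNorm x := by
  rw [netNorm, netNorm, ← Real.sqrt_sq_eq_abs, ← Real.sqrt_mul (sq_nonneg c), mul_sum]
  congr 1
  refine sum_congr rfl fun i _ => ?_
  rw [PiLp.smul_apply, map_smul_eq_mul, mul_pow, Real.norm_eq_abs, sq_abs]

theorem Assumptions.exists_norm_le (h : P.Assumptions) :
    ∃ c : ℝ, 0 < c ∧ ∀ x : Net (Fin m) d, ‖x‖ ≤ c * P.netNorm x := by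
  obtain ⟨c, hc, hle⟩ := exists_norm_le_mul_seminorm P.p h.p_definite
  refine ⟨c, hc, fun x => ?_⟩
  refine le_of_sq_le_sq ?_ (mul_nonneg hc.le (netNorm_nonneg x))
  rw [PiLp.norm_sq_eq_of_L2, mul_pow, netNorm_sq, mul_sum]
  refine sum_le_sum fun i _ => ?_
  rw [← mul_pow]
  exact pow_le_pow_left₀ (norm_nonneg _) (hle _) 2

/-- A connected graph on at least two vertices has an edge, and either matrix has a nonzero entry
there. Hence `𝒜 ≠ 0`, so every `T_k` is positive and the averages `x̂_k` are meaningful. -/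
theorem Assumptions.exists_entry_ne_zero (h : P.Assumptions) : ∃ r j, P.M r j ≠ 0 := by
  have : Nontrivial (Fin m) := Fin.nontrivial_iff_two_le.2 h.two_le_m
  obtain ⟨b, hab⟩ := h.connected.preconnected.exists_adj_of_nontrivial
    (⟨0, by have := h.two_le_m; omega⟩ : Fin m)
  set a : Fin m := ⟨0, by have := h.two_le_m; omega⟩
  rcases h.network with ⟨e, he⟩ | ⟨e, head, tail, he⟩
  · refine ⟨e.symm a, b, ?_⟩
    rw [he]
    simp [SimpleGraph.lapMatrix, SimpleGraph.degMatrix, hab, hab.ne]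
  · refine ⟨e.symm ⟨s(a, b), hab⟩, head (e.symm ⟨s(a, b), hab⟩), ?_⟩
    rw [(he _).2]
    simp

theorem Assumptions.half_netNorm_sq_le (h : P.Assumptions) {a x : Net (Fin m) d}
    (ha : a ∈ P.feasible) (hx : x ∈ P.feasible) : 1 / 2 * P.netNorm (x - a) ^ 2 ≤ P.V a x := by
  rw [netNorm_sq, mul_sum, V]
  exact sum_le_sum fun i _ => (h.prox i).half_sq_le_breg (ha i) (hx i)

theorem Assumptions.V_nonneg (h : P.Assumptions) {a x : Net (Fin m) d}
    (ha : a ∈ P.feasible) (hx : x ∈ P.feasible) : 0 ≤ P.V a x :=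
  (by positivity : (0 : ℝ) ≤ 1 / 2 * P.netNorm (x - a) ^ 2).trans (h.half_netNorm_sq_le ha hx)

theorem Assumptions.V_pos (h : P.Assumptions) {a x : Net (Fin m) d}
    (ha : a ∈ P.feasible) (hx : x ∈ P.feasible) (hne : a ≠ x) : 0 < P.V a x := by
  obtain ⟨c, hc, hle⟩ := h.exists_norm_le
  have h1 : 0 < ‖x - a‖ := norm_pos_iff.2 (sub_ne_zero.2 hne.symm)
  have h2 : 0 < P.netNorm (x - a) := pos_of_mul_pos_right (h1.trans_le (hle _)) hc.le
  exact lt_of_lt_of_le (by positivity) (h.half_netNorm_sq_le ha hx)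

theorem Assumptions.feasible_convex (h : P.Assumptions) : Convex ℝ P.feasible :=
  fun _ hx _ hy _ _ ha hb hab i => h.X_convex i (hx i) (hy i) ha hb hab

theorem convexOn_separable (hX : Convex ℝ P.feasible) {g : Fin m → Loc d → ℝ}
    (hg : ∀ i, ConvexOn ℝ (P.X i) (g i)) :
    ConvexOn ℝ P.feasible fun x : Net (Fin m) d => ∑ i, g i (x i) := by
  refine ⟨hX, fun x hx y hy a b ha hb hab => ?_⟩
  rw [smul_sum, smul_sum, ← sum_add_distrib]
  exact sum_le_sum fun i _ => (hg i).2 (hx i) (hy i) ha hb hab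

theorem Assumptions.nu_convex (h : P.Assumptions) (i : Fin m) : ConvexOn ℝ (P.X i) (P.ν i) := by
  refine ⟨h.X_convex i, fun x hx y hy a b ha hb hab => ?_⟩
  have h1 := (h.nu_strongly_convex i).2 x hx y hy a b ha hb hab
  have h2 : 0 ≤ a * b * (1 / 2 * P.p (x - y) ^ 2) := by positivity
  simp only [smul_eq_mul]
  linarith

/-- Adding an affine function to a multiple of `ν i` keeps convexity. -/
theorem Assumptions.nu_affine_convex (h : P.Assumptions) (i : Fin m) {g : Loc d → ℝ} {σ : ℝ}
    (hσ : 0 ≤ σ) (l : Loc d →ₗ[ℝ] ℝ) (C : ℝ) (hg : ∀ w, g w = σ * P.ν i w + l w + C) :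
    ConvexOn ℝ (P.X i) g := by
  refine ⟨h.X_convex i, fun x hx y hy a b ha hb hab => ?_⟩
  have h1 := mul_le_mul_of_nonneg_left ((h.nu_convex i).2 hx hy ha hb hab) hσ
  rw [hg, hg, hg, map_add, map_smul, map_smul]
  have h2 : C = a * C + b * C := by rw [← add_mul, hab, one_mul]
  simp only [smul_eq_mul] at h1 ⊢
  linarith

/-- `ν(x) = ∑ i, ν_i(x i)`. -/
def nuSum (P : Problem m d ρ) (x : Net (Fin m) d) : ℝ := ∑ i, P.ν i (x i)

variable [Fintype ρ]

theorem inner_AT (x : Net (Fin m) d) (z : Net ρ d) :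
    inner ℝ (P.AT z) x = inner ℝ (P.A x) z := by
  have h1 : ∀ i, inner ℝ (P.AT z i) (x i) = ∑ r, P.M r i * inner ℝ (x i) (z r) := fun i => by
    change inner ℝ (∑ r, P.M r i • z r) (x i) = _
    rw [sum_inner]
    exact sum_congr rfl fun r _ => by rw [real_inner_smul_left, real_inner_comm]
  have h2 : ∀ r, inner ℝ (P.A x r) (z r) = ∑ i, P.M r i * inner ℝ (x i) (z r) := fun r => by
    change inner ℝ (∑ i, P.M r i • x i) (z r) = _
    rw [sum_inner]
    exact sum_congr rfl fun i _ => by rw [real_inner_smul_left]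
  rw [PiLp.inner_apply, PiLp.inner_apply, sum_congr rfl fun i _ => h1 i,
    sum_congr rfl fun r _ => h2 r, sum_comm]

/-- A linear map on a finite-dimensional space is bounded. -/
theorem exists_linearMap_bound {E F : Type} [NormedAddCommGroup E] [NormedSpace ℝ E]
    [FiniteDimensional ℝ E] [NormedAddCommGroup F] [NormedSpace ℝ F] (f : E →ₗ[ℝ] F) :
    ∃ C : ℝ, 0 ≤ C ∧ ∀ x, ‖f x‖ ≤ C * ‖x‖ :=
  ⟨_, norm_nonneg _, fun x => (LinearMap.toContinuousLinearMap f).le_opNorm x⟩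

theorem Assumptions.norm_A_le (h : P.Assumptions) (x : Net (Fin m) d) :
    ‖P.A x‖ ≤ P.opNorm * P.netNorm x := by
  obtain ⟨c, hc, hle⟩ := h.exists_norm_le
  have hbdd : BddAbove {r | ∃ x : Net (Fin m) d, P.netNorm x ≤ 1 ∧ r = ‖P.A x‖} := by
    obtain ⟨C, hC, hb⟩ := exists_linearMap_bound P.AL
    refine ⟨C * c, ?_⟩
    rintro r ⟨x, hx, rfl⟩
    have h2 : ‖x‖ ≤ c := (hle x).trans (by nlinarith)
    exact (hb x).trans (mul_le_mul_of_nonneg_left h2 hC)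
  rcases (netNorm_nonneg (P := P) x).eq_or_lt with h0 | h0
  · have h1 := hle x
    rw [← h0, mul_zero] at h1
    have h2 : x = 0 := norm_le_zero_iff.1 h1
    rw [← h0, h2, A_eq, map_zero, norm_zero, mul_zero]
  · have h1 : ‖P.A ((P.netNorm x)⁻¹ • x)‖ ≤ P.opNorm := by
      refine le_csSup hbdd ⟨_, ?_, rfl⟩
      rw [netNorm_smul, abs_of_pos (inv_pos.2 h0), inv_mul_cancel₀ h0.ne']
    rw [A_eq, map_smul, norm_smul, norm_inv, Real.norm_of_nonneg h0.le, inv_mul_eq_div,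
      div_le_iff₀ h0] at h1
    exact h1

theorem Assumptions.opNorm_pos (h : P.Assumptions) : 0 < P.opNorm := by
  obtain ⟨r, j, hrj⟩ := h.exists_entry_ne_zero
  let v : Loc d := EuclideanSpace.single ⟨0, h.one_le_d⟩ 1
  have hv : v ≠ 0 := by
    intro h0
    have : ‖v‖ = 1 := by simp [v]
    simp [h0] at this
  let x : Net (Fin m) d := WithLp.toLp 2 (Pi.single j v)
  have hA : P.A x r = P.M r j • v := by
    simp only [A, x]
    rw [sum_eq_single j]
    · simp
    · intro i _ hi
      simp [Pi.single_eq_of_ne hi]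
    · simp
  have hne : P.A x ≠ 0 := by
    intro h0
    rw [h0] at hA
    exact smul_ne_zero hrj hv hA.symm
  have h1 := (norm_pos_iff.2 hne).trans_le (h.norm_A_le x)
  exact pos_of_mul_pos_left h1 (netNorm_nonneg x)

/-- The potential that couples consecutive inner iterations: a square. -/
def coupling (c w : ℝ) (z g u : Net ρ d) : ℝ :=
  c * ‖u - z‖ ^ 2 - w * inner ℝ g (z - u) + w ^ 2 * ‖g‖ ^ 2 / (4 * c)

theorem coupling_nonneg {c : ℝ} (hc : 0 < c) (w : ℝ) (z g u : Net ρ d) :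
    0 ≤ coupling c w z g u := by
  have h1 : coupling c w z g u = c * ‖(u - z) + (w / (2 * c)) • g‖ ^ 2 := by
    rw [coupling, norm_add_sq_real, norm_smul, real_inner_smul_right, mul_pow, Real.norm_eq_abs,
      sq_abs, ← neg_sub u z, inner_neg_right, real_inner_comm]
    field_simp
    ring
  rw [h1]
  positivity

/-- Expanding the two couplings leaves the square `c ‖(u' - u) - (w / 2c) g‖²`, which is dropped.
Here `u`, `u'` are successive multipliers and `g`, `g'` are images under `𝒜` of successive primal
increments. -/
theorem coupling_step {c : ℝ} (hc : 0 < c) (w w' : ℝ) (z g g' u u' : Net ρ d) :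
    inner ℝ ((2 * c) • (u' - u) + w' • g' - w • g) (z - u') - w' ^ 2 * ‖g'‖ ^ 2 / (4 * c) ≤
      coupling c w z g u - coupling c w' z g' u' := by
  have hsq : 0 ≤ c * ‖(u' - u) - (w / (2 * c)) • g‖ ^ 2 := by positivity
  rw [norm_sub_sq_real, norm_smul, real_inner_smul_right, mul_pow, Real.norm_eq_abs,
      sq_abs] at hsq
  have e1 : u - z = -((u' - u) + (z - u')) := by abel
  have e2 : z - u = (u' - u) + (z - u') := by abel
  have e3 : u' - z = -(z - u') := by abel
  rw [coupling, coupling, e1, e3, norm_neg, norm_neg, e2, norm_add_sq_real, inner_add_right]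
  simp only [inner_sub_left (_ + _) , inner_add_left, real_inner_smul_left]
  have e4 : c * (‖u' - u‖ ^ 2 - 2 * (w / (2 * c) * inner ℝ (u' - u) g)
      + (w / (2 * c)) ^ 2 * ‖g‖ ^ 2) =
      c * ‖u' - u‖ ^ 2 - w * inner ℝ g (u' - u) + w ^ 2 * ‖g‖ ^ 2 / (4 * c) := by
    rw [real_inner_comm]
    field_simp
    ring
  rw [e4] at hsq
  linarith

/-! One inner iteration. -/

variable {R : ℝ} {k t : ℕ} {xPrev y : Net (Fin m) d} {s : Inner m d ρ}

theorem innerStep_z (hq : 0 < P.qK R k) :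
    P.A (s.x + P.alphaKT R k t • (s.x - s.xOld)) =
      P.qK R k • ((P.innerStep R k t xPrev y s).z - s.z) := by
  ext1 r
  simp only [innerStep, PiLp.smul_apply, PiLp.sub_apply]
  rw [argmin_quadratic _ _ hq, smul_neg, sub_neg_eq_add, add_sub_cancel_left, smul_smul,
    mul_inv_cancel₀ hq.ne', one_smul]

theorem Assumptions.innerStep_x (h : P.Assumptions) (hη : 0 ≤ P.etaKT R k t) (hp : 0 < P.pK k)
    (hs : s.x ∈ P.feasible) :
    (P.innerStep R k t xPrev y s).x ∈ P.feasible ∧ ∀ w ∈ P.feasible,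
      P.μ * P.nuSum (P.innerStep R k t xPrev y s).x
        + inner ℝ (y + P.AT (P.innerStep R k t xPrev y s).z) (P.innerStep R k t xPrev y s).x
        + P.etaKT R k t * P.V s.x (P.innerStep R k t xPrev y s).x
        + P.pK k * P.V xPrev (P.innerStep R k t xPrev y s).x
        + (P.μ + P.etaKT R k t + P.pK k) * P.V (P.innerStep R k t xPrev y s).x w ≤
      P.μ * P.nuSum w + inner ℝ (y + P.AT (P.innerStep R k t xPrev y s).z) w
        + P.etaKT R k t * P.V s.x w + P.pK k * P.V xPrev w := by
  have hσ : 0 < P.μ + P.etaKT R k t + P.pK k := by linarith [h.mu_nonneg]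
  set s' := P.innerStep R k t xPrev y s with hs'
  have key : ∀ i, s'.x i ∈ P.X i ∧ ∀ w ∈ P.X i,
      P.μ * P.ν i (s'.x i) + inner ℝ (y i + (P.AT s'.z) i) (s'.x i)
        + P.etaKT R k t * P.Vi i (s.x i) (s'.x i) + P.pK k * P.Vi i (xPrev i) (s'.x i)
        + (P.μ + P.etaKT R k t + P.pK k) * P.Vi i (s'.x i) w ≤
      P.μ * P.ν i w + inner ℝ (y i + (P.AT s'.z) i) w
        + P.etaKT R k t * P.Vi i (s.x i) w + P.pK k * P.Vi i (xPrev i) w := by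
    intro i
    have h1 := (h.prox i).argmin_spec (b := xPrev i) (hs i) hσ (y i + (P.AT s'.z) i)
    exact ⟨h1.1, fun w hw => h1.2 w hw _ rfl⟩
  refine ⟨fun i => (key i).1, fun w hw => ?_⟩
  have h2 := sum_le_sum fun i (_ : i ∈ univ) => (key i).2 (w i) (hw i)
  simp only [sum_add_distrib, ← mul_sum] at h2
  exact h2

/-- The objective of one prox-step without the term for the previous inner iterate, paired with a
fixed multiplier `z`. -/
def stepObj (P : Problem m d ρ) (k : ℕ) (xPrev y : Net (Fin m) d) (z : Net ρ d)
    (x : Net (Fin m) d) : ℝ :=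
  P.μ * P.nuSum x + inner ℝ y x + inner ℝ (P.A x) z + P.pK k * P.V xPrev x

/-- Each `V_i(a, ·)` is `ν_i` plus an affine function, so on a block the objective is `(μ + p_k)
ν_i` plus an affine function. Keeping `p_k V` inside the convex function lets Jensen's inequality
pass it to `x̂_k`. -/
theorem Assumptions.stepObj_convex (h : P.Assumptions) (hp : 0 ≤ P.pK k) (z : Net ρ d) :
    ConvexOn ℝ P.feasible (P.stepObj k xPrev y z) := by
  have h1 := convexOn_separable h.feasible_convex
    (g := fun i w => P.μ * P.ν i w + inner ℝ (y i) w + inner ℝ (P.AT z i) w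
      + P.pK k * P.Vi i (xPrev i) w) fun i =>
    h.nu_affine_convex i (σ := P.μ + P.pK k) (by linarith [h.mu_nonneg])
      ((innerSL ℝ (y i) + innerSL ℝ (P.AT z i)
        - P.pK k • fderivWithin ℝ (P.ν i) (P.X i) (xPrev i) : Loc d →L[ℝ] ℝ) : Loc d →ₗ[ℝ] ℝ)
      (P.pK k * (fderivWithin ℝ (P.ν i) (P.X i) (xPrev i) (xPrev i) - P.ν i (xPrev i)))
      (fun w => by
        simp only [Vi, map_sub]
        simp
        ring)
  refine h1.congr fun x _ => ?_
  simp only [stepObj, sum_add_distrib, ← mul_sum, ← inner_AT]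
  rfl

variable {z : Net ρ d} {w : Net (Fin m) d} {c θ : ℝ}

/-- The prox inequality involves the new multiplier `z'` instead of `z`. The difference `⟨𝒜 x', z -
z'⟩` is what `coupling_step` bounds, and its quadratic error is paid by `η V(x, x')` through strong
convexity and `hcoup`. -/
theorem Assumptions.inner_progress (h : P.Assumptions) (hη : 0 ≤ P.etaKT R k t) (hp : 0 < P.pK k)
    (hq : 0 < P.qK R k) (hs : s.x ∈ P.feasible) (hw : w ∈ P.feasible) (hAw : P.A w = 0)
    (hθ : 0 < θ) (hc : 0 < c) (hcq : θ * P.qK R k = 2 * c)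
    (hcoup : θ * P.opNorm ^ 2 ≤ 2 * c * P.etaKT R k t) :
    θ * (P.stepObj k xPrev y z (P.innerStep R k t xPrev y s).x - P.stepObj k xPrev y z w) ≤
      θ * (P.etaKT R k t * P.V s.x w
        - (P.μ + P.etaKT R k t + P.pK k) * P.V (P.innerStep R k t xPrev y s).x w)
      + coupling c (θ * P.alphaKT R k t) z (P.A (s.x - s.xOld)) s.z
      - coupling c θ z (P.A ((P.innerStep R k t xPrev y s).x - s.x))
          (P.innerStep R k t xPrev y s).z := by
  obtain ⟨hx', hprox⟩ := h.innerStep_x (xPrev := xPrev) (y := y) hη hp hs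
  have hz := innerStep_z (t := t) (xPrev := xPrev) (y := y) (s := s) hq
  set s' := P.innerStep R k t xPrev y s
  have h1 := mul_le_mul_of_nonneg_left (hprox w hw) hθ.le
  have h2 := coupling_step hc (θ * P.alphaKT R k t) θ z (P.A (s.x - s.xOld)) (P.A (s'.x - s.x))
    s.z s'.z
  -- The dual step is `q (z' - z) = 𝒜 ũ`. Hence the extrapolation cancels the old increment and `𝒜
  -- x'` remains.
  have h3 : (2 * c) • (s'.z - s.z) + θ • P.A (s'.x - s.x)
      - (θ * P.alphaKT R k t) • P.A (s.x - s.xOld) = θ • P.A s'.x := by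
    rw [← hcq, mul_smul, ← hz]
    simp only [A_eq, map_add, map_sub, map_smul]
    module
  rw [h3, real_inner_smul_left, inner_sub_right] at h2
  have h4 : θ ^ 2 * ‖P.A (s'.x - s.x)‖ ^ 2 / (4 * c) ≤ θ * (P.etaKT R k t * P.V s.x s'.x) := by
    rw [div_le_iff₀ (by positivity)]
    have h5 : ‖P.A (s'.x - s.x)‖ ^ 2 ≤ P.opNorm ^ 2 * P.netNorm (s'.x - s.x) ^ 2 := by
      rw [← mul_pow]
      exact pow_le_pow_left₀ (norm_nonneg _) (h.norm_A_le _) 2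
    have h6 := h.half_netNorm_sq_le hs hx'
    calc θ ^ 2 * ‖P.A (s'.x - s.x)‖ ^ 2
        ≤ θ ^ 2 * (P.opNorm ^ 2 * P.netNorm (s'.x - s.x) ^ 2) := by gcongr
      _ = θ * (θ * P.opNorm ^ 2) * P.netNorm (s'.x - s.x) ^ 2 := by ring
      _ ≤ θ * (2 * c * P.etaKT R k t) * P.netNorm (s'.x - s.x) ^ 2 := by gcongr
      _ = 4 * c * θ * P.etaKT R k t * (1 / 2 * P.netNorm (s'.x - s.x) ^ 2) := by ring
      _ ≤ 4 * c * θ * P.etaKT R k t * P.V s.x s'.x := by gcongr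
      _ = _ := by ring
  rw [inner_add_left, inner_add_left, inner_AT, inner_AT, hAw, inner_zero_left] at h1
  simp only [stepObj, hAw, inner_zero_left]
  linarith

/-! The inner loop. -/

theorem etaKT_succ (t : ℕ) : P.etaKT R k (t + 1) = P.μ + P.etaKT R k t + P.pK k := by
  rw [etaKT, etaKT]
  push_cast
  ring

theorem etaKT_ge (hμ : 0 ≤ P.μ) (hp : 0 ≤ P.pK k) (ht : 1 ≤ t) :
    P.pK k * P.TK R k ≤ P.etaKT R k t := by
  have h1 : (1 : ℝ) ≤ t := by exact_mod_cast ht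
  rw [etaKT]
  have : 0 ≤ (P.pK k + P.μ) * ((t : ℝ) - 1) := mul_nonneg (by linarith) (by linarith)
  linarith

theorem alphaKT_of_two_le (ht : 2 ≤ t) : P.alphaKT R k t = 1 := by
  rw [alphaKT, if_neg (by omega)]

theorem innerIter_xOld (n : ℕ) :
    (P.innerIter R k xPrev y s (n + 1)).xOld = (P.innerIter R k xPrev y s n).x := rfl

theorem innerIter_comms (n : ℕ) :
    (P.innerIter R k xPrev y s n).comms = s.comms + 2 * n := by
  induction n with
  | zero => rfl
  | succ n ih =>
    change (P.innerIter R k xPrev y s n).comms + 2 = _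
    rw [ih]
    ring

theorem Assumptions.innerIter_feasible (h : P.Assumptions) (hp : 0 < P.pK k)
    (hs : s.x ∈ P.feasible) (n : ℕ) : (P.innerIter R k xPrev y s n).x ∈ P.feasible := by
  induction n with
  | zero => exact hs
  | succ n ih =>
    have := etaKT_ge (R := R) (t := n + 1) h.mu_nonneg hp.le (by omega)
    exact (h.innerStep_x (le_trans (by positivity) this) hp ih).1

/-- The steps telescope because `η^{t+1} = μ + η^t + p` and `α^t = 1` from the second step on. With
`α^{n+1}` in the final coupling, the case `n = 0` is an equality. -/
theorem Assumptions.innerIter_progress (h : P.Assumptions) (hp : 0 < P.pK k)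
    (hq : 0 < P.qK R k) (hs : s.x ∈ P.feasible) (hw : w ∈ P.feasible) (hAw : P.A w = 0)
    (hθ : 0 < θ) (hc : 0 < c) (hcq : θ * P.qK R k = 2 * c)
    (hcoup : θ * P.opNorm ^ 2 ≤ 2 * c * (P.pK k * P.TK R k)) (n : ℕ) :
    θ * ∑ t ∈ Icc 1 n,
        (P.stepObj k xPrev y z (P.innerIter R k xPrev y s t).x - P.stepObj k xPrev y z w) ≤
      θ * (P.etaKT R k 1 * P.V s.x w
        - P.etaKT R k (n + 1) * P.V (P.innerIter R k xPrev y s n).x w)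
      + coupling c (θ * P.alphaKT R k 1) z (P.A (s.x - s.xOld)) s.z
      - coupling c (θ * P.alphaKT R k (n + 1)) z
          (P.A ((P.innerIter R k xPrev y s n).x - (P.innerIter R k xPrev y s n).xOld))
          (P.innerIter R k xPrev y s n).z := by
  induction n with
  | zero =>
    change θ * ∑ t ∈ Icc 1 0, _ ≤ θ * (P.etaKT R k 1 * P.V s.x w - P.etaKT R k 1 * P.V s.x w)
      + coupling c (θ * P.alphaKT R k 1) z (P.A (s.x - s.xOld)) s.z
      - coupling c (θ * P.alphaKT R k 1) z (P.A (s.x - s.xOld)) s.z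
    simp
  | succ n ih =>
    have hη := etaKT_ge (R := R) (t := n + 1) h.mu_nonneg hp.le (by omega)
    have h1 := h.inner_progress (k := k) (R := R) (t := n + 1) (xPrev := xPrev) (y := y) (z := z)
      (s := P.innerIter R k xPrev y s n)
      (le_trans (by positivity) hη) hp hq (h.innerIter_feasible hp hs n) hw hAw hθ hc hcq
      (hcoup.trans (by gcongr))
    rw [sum_Icc_succ_top (by omega), mul_add, alphaKT_of_two_le (t := n + 1 + 1) (by omega),
      mul_one, etaKT_succ (n + 1), innerIter_xOld]
    change θ * (P.stepObj k xPrev y z (P.innerIter R k xPrev y s (n + 1)).x - _) ≤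
      θ * (_ - _ * P.V (P.innerIter R k xPrev y s (n + 1)).x w) + _ -
      coupling c θ z (P.A ((P.innerIter R k xPrev y s (n + 1)).x - _))
        (P.innerIter R k xPrev y s (n + 1)).z at h1
    linarith

end Network

/-! ### The outer loop: gradient extrapolation, the potential and the convergence bounds. -/

section OuterLoop

variable {m d : ℕ} {ρ : Type} {P : Problem m d ρ}

/-- The gradient of `f̃`. -/
def gradF (P : Problem m d ρ) (x : Net (Fin m) d) : Net (Fin m) d :=
  WithLp.toLp 2 fun i => gradient (P.ft i) (x i)

/-- The Bregman distance of `f̃`. -/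
def bregF (P : Problem m d ρ) (u v : Net (Fin m) d) : ℝ := ∑ i, breg (P.ft i) (u i) (v i)

/-- `f̃`. -/
def ftSum (P : Problem m d ρ) (x : Net (Fin m) d) : ℝ := ∑ i, P.ft i (x i)

theorem f_eq (x : Net (Fin m) d) : P.f x = P.ftSum x + P.μ * P.nuSum x := by
  rw [f, ftSum, nuSum, sum_add_distrib, mul_sum]

theorem bregF_eq (u v : Net (Fin m) d) :
    P.bregF u v = P.ftSum u - P.ftSum v - inner ℝ (P.gradF v) (u - v) := by
  rw [PiLp.inner_apply, bregF, ftSum, ftSum, ← sum_sub_distrib, ← sum_sub_distrib]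
  rfl

theorem Assumptions.bregF_nonneg (h : P.Assumptions) (u v : Net (Fin m) d) : 0 ≤ P.bregF u v :=
  sum_nonneg fun i _ => (h.smooth i).breg_nonneg _ _

theorem Assumptions.inner_gradF_sub_le (h : P.Assumptions) (u v x : Net (Fin m) d) (s : ℝ) :
    s * inner ℝ (P.gradF u - P.gradF v) x ≤ P.bregF u v + P.L / 2 * s ^ 2 * P.netNorm x ^ 2 := by
  rw [PiLp.inner_apply, bregF, netNorm_sq, mul_sum, mul_sum, ← sum_add_distrib]
  exact sum_le_sum fun i _ => (h.smooth i).inner_gradient_sub_le _ _ _ s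

/-- The exact three-point identity for the gradient extrapolation step. -/
theorem linearization_identity {u u' v x xt : Net (Fin m) d} {τ : ℝ}
    (hxt : (1 + τ) • u' = xt + τ • u) :
    P.ftSum v + inner ℝ (P.gradF v) (x - v) - (P.ftSum u' + inner ℝ (P.gradF u') (x - u')) =
      inner ℝ (P.gradF v - P.gradF u') (x - xt) + τ * P.bregF u v - (1 + τ) * P.bregF u' v
        - τ * P.bregF u u' := by
  have h1 : xt = (1 + τ) • u' - τ • u := by rw [hxt, add_sub_cancel_right]
  rw [bregF_eq, bregF_eq, bregF_eq, h1]
  simp only [inner_sub_left, inner_sub_right, real_inner_smul_right]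
  ring

/-- The error of the gradient extrapolation is absorbed. -/
theorem Assumptions.extrapolation_le (h : P.Assumptions) (n : ℕ) (u u' x : Net (Fin m) d) :
    - P.betaK n * inner ℝ (P.gradF u - P.gradF u') x
      - P.betaK (n + 1) * P.tauK (n + 1) * P.bregF u u' ≤
      P.betaK n * P.pK n / 2 * P.netNorm x ^ 2 := by
  rcases Nat.eq_zero_or_pos n with rfl | hn
  · rw [betaK_zero, zero_add, tauK_one]
    simp
  · have hL := h.L_pos
    have hβ := betaK_pos h.mu_nonneg hL (k := n + 1) (by omega)
    have hβ' := betaK_pos h.mu_nonneg hL hn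
    have hτ := tauK_succ_pos h.mu_nonneg hL hn
    -- This multiple, scaled by `β_{n+1} τ_{n+1}`, spends exactly the available Bregman distance,
    -- and `β_{n+1} λ_{n+1} = β_n` restores the inner product.
    have h1 := h.inner_gradF_sub_le u u' x (-(P.lamK (n + 1) / P.tauK (n + 1)))
    have h2 := L_mul_lamK_le h.mu_nonneg hL hn
    have h3 := betaK_mul_lamK h.mu_nonneg hL n
    have h4 := mul_le_mul_of_nonneg_left h1 (mul_pos hβ hτ).le
    have e1 : P.betaK (n + 1) * P.tauK (n + 1) * (-(P.lamK (n + 1) / P.tauK (n + 1))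
        * inner ℝ (P.gradF u - P.gradF u') x) =
        - P.betaK n * inner ℝ (P.gradF u - P.gradF u') x := by
      rw [← h3]
      field_simp
    have e2 : P.betaK (n + 1) * P.tauK (n + 1) * (P.bregF u u'
        + P.L / 2 * (-(P.lamK (n + 1) / P.tauK (n + 1))) ^ 2 * P.netNorm x ^ 2) =
        P.betaK (n + 1) * P.tauK (n + 1) * P.bregF u u'
        + P.betaK n * (P.L * P.lamK (n + 1)) / (2 * P.tauK (n + 1)) * P.netNorm x ^ 2 := by
      rw [← h3]
      field_simp
    rw [e1, e2] at h4
    have h5 : P.betaK n * (P.L * P.lamK (n + 1)) / (2 * P.tauK (n + 1)) ≤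
        P.betaK n * P.pK n / 2 := by
      rw [div_le_div_iff₀ (by positivity) two_pos]
      nlinarith
    have h6 := mul_le_mul_of_nonneg_right h5 (sq_nonneg (P.netNorm x))
    linarith

variable [Fintype ρ] {R : ℝ} {x0 xl0 : Net (Fin m) d}

theorem qK_pos (hμ : 0 ≤ P.μ) (hL : 0 < P.L) (hR : 0 < R) (hA : 0 < P.opNorm) {k : ℕ}
    (hk : 1 ≤ k) : 0 < P.qK R k := by
  have h1 : (0 : ℝ) < P.TK R k := by exact_mod_cast TK_pos hμ hL hR hA hk
  have h2 := betaK_pos hμ hL hk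
  rw [qK]
  positivity

variable (P R x0 xl0) in
/-- The state of the inner loop of outer iteration `n + 1` after `t` iterations. -/
def loopState (n t : ℕ) : Inner m d ρ :=
  P.innerIter R (n + 1) (P.run R x0 xl0 n).x (P.gradF (P.run R x0 xl0 (n + 1)).xLow)
    { xOld := (P.run R x0 xl0 n).xTail, x := (P.run R x0 xl0 n).x,
      z := (P.run R x0 xl0 n).z, comms := (P.run R x0 xl0 n).comms } t

theorem run_succ_x (n : ℕ) :
    (P.run R x0 xl0 (n + 1)).x = (P.loopState R x0 xl0 n (P.TK R (n + 1))).x := rfl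

theorem run_succ_xTail (n : ℕ) :
    (P.run R x0 xl0 (n + 1)).xTail = (P.loopState R x0 xl0 n (P.TK R (n + 1))).xOld := rfl

theorem run_succ_z (n : ℕ) :
    (P.run R x0 xl0 (n + 1)).z = (P.loopState R x0 xl0 n (P.TK R (n + 1))).z := rfl

theorem run_succ_xPrev (n : ℕ) : (P.run R x0 xl0 (n + 1)).xPrev = (P.run R x0 xl0 n).x := rfl

theorem run_succ_xHat (n : ℕ) : (P.run R x0 xl0 (n + 1)).xHat =
    ((P.TK R (n + 1) : ℕ) : ℝ)⁻¹ • ∑ t ∈ Icc 1 (P.TK R (n + 1)), (P.loopState R x0 xl0 n t).x := rfl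

theorem run_succ_xLow (n : ℕ) : (P.run R x0 xl0 (n + 1)).xLow =
    (1 + P.tauK (n + 1))⁻¹ • ((P.run R x0 xl0 n).x
      + P.lamK (n + 1) • ((P.run R x0 xl0 n).xHat - (P.run R x0 xl0 n).xPrev)
      + P.tauK (n + 1) • (P.run R x0 xl0 n).xLow) := rfl

theorem run_grads (n : ℕ) : (P.run R x0 xl0 n).grads = n := by
  induction n with
  | zero => rfl
  | succ n ih =>
    change (P.run R x0 xl0 n).grads + 1 = _
    rw [ih]

theorem run_comms (n : ℕ) :
    (P.run R x0 xl0 n).comms = ∑ k ∈ Icc 1 n, 2 * P.TK R k := by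
  induction n with
  | zero => rfl
  | succ n ih =>
    rw [sum_Icc_succ_top (by omega), ← ih]
    exact innerIter_comms _

theorem Assumptions.run_x_feasible (h : P.Assumptions) (hx0 : x0 ∈ P.feasible) (n : ℕ) :
    (P.run R x0 xl0 n).x ∈ P.feasible := by
  induction n with
  | zero => exact hx0
  | succ n ih => exact h.innerIter_feasible (pK_pos h.L_pos (by omega)) ih _

theorem Assumptions.loopState_feasible (h : P.Assumptions) (hx0 : x0 ∈ P.feasible) (n t : ℕ) :
    (P.loopState R x0 xl0 n t).x ∈ P.feasible :=
  h.innerIter_feasible (pK_pos h.L_pos (by omega)) (h.run_x_feasible hx0 n) t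

/-- Jensen's inequality for the average of the inner iterates. -/
theorem Assumptions.xHat_jensen (h : P.Assumptions) (hR : 0 < R) (hx0 : x0 ∈ P.feasible) (n : ℕ) :
    (P.run R x0 xl0 (n + 1)).xHat ∈ P.feasible ∧
    ∀ g : Net (Fin m) d → ℝ, ConvexOn ℝ P.feasible g →
      P.TK R (n + 1) * g (P.run R x0 xl0 (n + 1)).xHat ≤
        ∑ t ∈ Icc 1 (P.TK R (n + 1)), g (P.loopState R x0 xl0 n t).x := by
  have hT : (0 : ℝ) < P.TK R (n + 1) := by
    exact_mod_cast TK_pos h.mu_nonneg h.L_pos hR h.opNorm_pos (by omega)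
  have hsum : ∑ _t ∈ Icc 1 (P.TK R (n + 1)), ((P.TK R (n + 1) : ℕ) : ℝ)⁻¹ = 1 := by
    rw [sum_const, Nat.card_Icc, Nat.add_sub_cancel, nsmul_eq_mul, mul_inv_cancel₀ hT.ne']
  have hmem : ∀ t ∈ Icc 1 (P.TK R (n + 1)), (P.loopState R x0 xl0 n t).x ∈ P.feasible :=
    fun t _ => h.loopState_feasible hx0 n t
  refine ⟨?_, fun g hg => ?_⟩
  · rw [run_succ_xHat, smul_sum]
    exact h.feasible_convex.sum_mem (fun _ _ => inv_nonneg.2 hT.le) hsum hmem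
  · have h1 := hg.map_sum_le (fun _ _ => inv_nonneg.2 hT.le) hsum hmem
    rw [← smul_sum, ← smul_sum, ← run_succ_xHat, smul_eq_mul] at h1
    calc _ ≤ P.TK R (n + 1) * (((P.TK R (n + 1) : ℕ) : ℝ)⁻¹ * _) :=
          mul_le_mul_of_nonneg_left h1 hT.le
      _ = _ := mul_inv_cancel_left₀ hT.ne' _

variable {w v : Net (Fin m) d} {z : Net ρ d}

/-- The primal-dual part of the progress of one outer iteration. -/
theorem Assumptions.loop_progress (h : P.Assumptions) (hR : 0 < R) (hx0 : x0 ∈ P.feasible)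
    (hw : w ∈ P.feasible) (hAw : P.A w = 0) (n : ℕ) :
    P.betaK (n + 1) * (P.stepObj (n + 1) (P.run R x0 xl0 n).x
          (P.gradF (P.run R x0 xl0 (n + 1)).xLow) z (P.run R x0 xl0 (n + 1)).xHat
        - P.stepObj (n + 1) (P.run R x0 xl0 n).x
          (P.gradF (P.run R x0 xl0 (n + 1)).xLow) z w) ≤
      P.betaK (n + 1) * (P.pK (n + 1) * P.V (P.run R x0 xl0 n).x w
        - (2 * P.pK (n + 1) + P.μ) * P.V (P.run R x0 xl0 (n + 1)).x w)
      + coupling (P.L / (4 * R ^ 2)) (P.betaK (n + 1) / P.TK R (n + 1) * P.alphaKT R (n + 1) 1) z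
          (P.A ((P.run R x0 xl0 n).x - (P.run R x0 xl0 n).xTail)) (P.run R x0 xl0 n).z
      - coupling (P.L / (4 * R ^ 2)) (P.betaK (n + 1) / P.TK R (n + 1)) z
          (P.A ((P.run R x0 xl0 (n + 1)).x - (P.run R x0 xl0 (n + 1)).xTail))
          (P.run R x0 xl0 (n + 1)).z := by
  have hL := h.L_pos
  have hTn := TK_pos h.mu_nonneg hL hR h.opNorm_pos (k := n + 1) (by omega)
  have hT : (0 : ℝ) < P.TK R (n + 1) := by exact_mod_cast hTn
  have hβ := betaK_pos h.mu_nonneg hL (k := n + 1) (by omega)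
  have hp := pK_pos hL (P := P) (k := n + 1) (by omega)
  -- With this weight `θ T_k = β_k`, and `θ q_k = L / (2R²)` does not depend on `k`, so all outer
  -- iterations share the same coupling constant.
  set θ := P.betaK (n + 1) / P.TK R (n + 1) with hθ
  have hθβ : θ * P.TK R (n + 1) = P.betaK (n + 1) := div_mul_cancel₀ _ hT.ne'
  have hcq : θ * P.qK R (n + 1) = 2 * (P.L / (4 * R ^ 2)) := by
    rw [hθ, qK]
    field_simp
    ring
  have hcoup : θ * P.opNorm ^ 2 ≤ 2 * (P.L / (4 * R ^ 2)) * (P.pK (n + 1) * P.TK R (n + 1)) := by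
    have h1 := two_betaK_mul_opNorm_sq_le h.mu_nonneg hL hR h.opNorm_pos (k := n + 1) (by omega)
    have e : 2 * (P.L / (4 * R ^ 2)) * (P.pK (n + 1) * P.TK R (n + 1)) =
        P.L * P.pK (n + 1) * (P.TK R (n + 1) : ℝ) ^ 2 / (2 * R ^ 2 * P.TK R (n + 1)) := by
      field_simp
      ring
    rw [e, hθ, div_mul_eq_mul_div, div_le_div_iff₀ hT (by positivity)]
    nlinarith
  have h1 := h.innerIter_progress (k := n + 1) (R := R) (xPrev := (P.run R x0 xl0 n).x)
    (y := P.gradF (P.run R x0 xl0 (n + 1)).xLow) (z := z)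
    (s := { xOld := (P.run R x0 xl0 n).xTail, x := (P.run R x0 xl0 n).x,
            z := (P.run R x0 xl0 n).z, comms := (P.run R x0 xl0 n).comms })
    hp (qK_pos h.mu_nonneg hL hR h.opNorm_pos (by omega)) (h.run_x_feasible hx0 n) hw hAw
    (div_pos hβ hT) (c := P.L / (4 * R ^ 2)) (by positivity) hcq hcoup (P.TK R (n + 1))
  rw [alphaKT_of_two_le (t := P.TK R (n + 1) + 1) (by omega), mul_one, sum_sub_distrib, sum_const,
    Nat.card_Icc, Nat.add_sub_cancel, nsmul_eq_mul] at h1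
  have h2 := (h.xHat_jensen hR hx0 (xl0 := xl0) n).2 _
    (h.stepObj_convex (k := n + 1) (xPrev := (P.run R x0 xl0 n).x)
      (y := P.gradF (P.run R x0 xl0 (n + 1)).xLow) hp.le z)
  have e1 : P.etaKT R (n + 1) 1 = P.pK (n + 1) * P.TK R (n + 1) := by
    rw [etaKT]
    push_cast
    ring
  have e2 : P.etaKT R (n + 1) (P.TK R (n + 1) + 1) =
      (2 * P.pK (n + 1) + P.μ) * P.TK R (n + 1) := by
    rw [etaKT]
    push_cast
    ring
  rw [e1, e2] at h1
  have h3 := mul_le_mul_of_nonneg_left h2 (div_pos hβ hT).le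
  rw [← hθ] at h3
  rw [run_succ_x, run_succ_xTail, run_succ_z]
  rw [← hθβ]
  simp only [loopState] at h3 ⊢
  linarith

/-- The contribution of the point `x` to the primal-dual gap: the linearization of `f̃` at `v`
replaces `f̃`. -/
def gapObj (P : Problem m d ρ) (v : Net (Fin m) d) (z : Net ρ d) (x : Net (Fin m) d) : ℝ :=
  P.ftSum v + inner ℝ (P.gradF v) (x - v) + P.μ * P.nuSum x + inner ℝ (P.A x) z

theorem Assumptions.gapObj_convex (h : P.Assumptions) (v : Net (Fin m) d) (z : Net ρ d) :
    ConvexOn ℝ P.feasible (P.gapObj v z) := by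
  have h1 := convexOn_separable h.feasible_convex
    (g := fun i w => P.ft i (v i) + inner ℝ (P.gradF v i) (w - v i) + P.μ * P.ν i w
      + inner ℝ (P.AT z i) w) fun i =>
    h.nu_affine_convex i (σ := P.μ) h.mu_nonneg
      ((innerSL ℝ (P.gradF v i) + innerSL ℝ (P.AT z i) : Loc d →L[ℝ] ℝ) : Loc d →ₗ[ℝ] ℝ)
      (P.ft i (v i) - inner ℝ (P.gradF v i) (v i))
      (fun w => by
        rw [inner_sub_right]
        simp
        ring)
  refine h1.congr fun x _ => ?_
  simp only [gapObj, sum_add_distrib, ← mul_sum, ← inner_AT]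
  rfl

variable (P R x0 xl0) in
/-- The extrapolation `x̂_n - x_{n-1}`. -/
def shift (n : ℕ) : Net (Fin m) d := (P.run R x0 xl0 n).xHat - (P.run R x0 xl0 n).xPrev

variable (P R x0 xl0) in
/-- The potential after `n` outer iterations. -/
def potential (v w : Net (Fin m) d) (z : Net ρ d) (n : ℕ) : ℝ :=
  coupling (P.L / (4 * R ^ 2)) (P.betaK n / P.TK R n) z
      (P.A ((P.run R x0 xl0 n).x - (P.run R x0 xl0 n).xTail)) (P.run R x0 xl0 n).z
  + P.betaK n * (2 * P.pK n + P.μ) * P.V (P.run R x0 xl0 n).x w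
  + P.betaK n * (1 + P.tauK n) * P.bregF (P.run R x0 xl0 n).xLow v
  - P.betaK n * inner ℝ (P.gradF v - P.gradF (P.run R x0 xl0 n).xLow) (P.shift R x0 xl0 n)
  + P.betaK n * P.pK n / 2 * P.netNorm (P.shift R x0 xl0 n) ^ 2

variable (P R x0 xl0) in
/-- The part of the potential after `n` outer iterations that iteration `n + 1` can use. -/
def available (v w : Net (Fin m) d) (z : Net ρ d) (n : ℕ) : ℝ :=
  coupling (P.L / (4 * R ^ 2)) (P.betaK (n + 1) / P.TK R (n + 1) * P.alphaKT R (n + 1) 1) z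
      (P.A ((P.run R x0 xl0 n).x - (P.run R x0 xl0 n).xTail)) (P.run R x0 xl0 n).z
  + 2 * P.betaK (n + 1) * P.pK (n + 1) * P.V (P.run R x0 xl0 n).x w
  + P.betaK (n + 1) * P.tauK (n + 1) * P.bregF (P.run R x0 xl0 n).xLow v
  - P.betaK n * inner ℝ (P.gradF v - P.gradF (P.run R x0 xl0 n).xLow) (P.shift R x0 xl0 n)
  + P.betaK n * P.pK n / 2 * P.netNorm (P.shift R x0 xl0 n) ^ 2

/-- Adds the inner loop estimate, the linearization identity and convexity of `f̃` at `w`. Since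
`x̂_{n+1} - x̃_{n+1}` is the new shift minus `λ_{n+1}` times the old one, the inner products
telescope up to the gradient change, which `extrapolation_le` absorbs. The Jensen term `p V(x_n,
x̂_{n+1})` is stored for the next iteration. -/
theorem Assumptions.outer_progress (h : P.Assumptions) (hR : 0 < R) (hx0 : x0 ∈ P.feasible)
    (hw : w ∈ P.feasible) (hAw : P.A w = 0) (n : ℕ) :
    P.betaK (n + 1) * (P.gapObj v z (P.run R x0 xl0 (n + 1)).xHat - P.f w) ≤
      P.available R x0 xl0 v w z n - P.potential R x0 xl0 v w z (n + 1) := by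
  have hβ := betaK_pos h.mu_nonneg h.L_pos (k := n + 1) (by omega)
  have hp := pK_pos h.L_pos (P := P) (k := n + 1) (by omega)
  have hτ := tauK_nonneg (P := P) (k := n + 1) (by omega)
  have h1 := h.loop_progress (xl0 := xl0) (z := z) hR hx0 hw hAw n
  have h2 := h.extrapolation_le n (P.run R x0 xl0 n).xLow (P.run R x0 xl0 (n + 1)).xLow
    (P.shift R x0 xl0 n)
  have hxt : (1 + P.tauK (n + 1)) • (P.run R x0 xl0 (n + 1)).xLow =
      ((P.run R x0 xl0 n).x + P.lamK (n + 1) • P.shift R x0 xl0 n)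
        + P.tauK (n + 1) • (P.run R x0 xl0 n).xLow := by
    rw [run_succ_xLow, smul_smul, mul_inv_cancel₀ (by linarith), one_smul, shift]
  have h3 := linearization_identity (P := P) (v := v) (x := (P.run R x0 xl0 (n + 1)).xHat) hxt
  have h4 := h.bregF_nonneg w (P.run R x0 xl0 (n + 1)).xLow
  rw [bregF_eq] at h4
  have h5 := h.half_netNorm_sq_le (h.run_x_feasible (R := R) (xl0 := xl0) hx0 n)
    (h.xHat_jensen (xl0 := xl0) hR hx0 n).1
  have e1 : (P.run R x0 xl0 (n + 1)).xHat
      - ((P.run R x0 xl0 n).x + P.lamK (n + 1) • P.shift R x0 xl0 n) =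
      P.shift R x0 xl0 (n + 1) - P.lamK (n + 1) • P.shift R x0 xl0 n := by
    rw [shift.eq_def P R x0 xl0 (n + 1), run_succ_xPrev]
    abel
  rw [e1] at h3
  have e2 : P.shift R x0 xl0 (n + 1) =
      (P.run R x0 xl0 (n + 1)).xHat - (P.run R x0 xl0 n).x := rfl
  rw [← e2] at h5
  have h3' := congrArg (P.betaK (n + 1) * ·) h3
  have h5' := mul_le_mul_of_nonneg_left h5 (mul_pos hβ hp).le
  have h4' := mul_le_mul_of_nonneg_left h4 hβ.le
  simp only [stepObj, hAw, inner_zero_left] at h1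
  rw [gapObj, potential, available, f_eq]
  have e3 : inner ℝ (P.gradF v - P.gradF (P.run R x0 xl0 (n + 1)).xLow)
      (P.shift R x0 xl0 (n + 1) - P.lamK (n + 1) • P.shift R x0 xl0 n) =
      inner ℝ (P.gradF v - P.gradF (P.run R x0 xl0 (n + 1)).xLow) (P.shift R x0 xl0 (n + 1))
      - P.lamK (n + 1) * (inner ℝ (P.gradF v - P.gradF (P.run R x0 xl0 n).xLow)
          (P.shift R x0 xl0 n)
        + inner ℝ (P.gradF (P.run R x0 xl0 n).xLow - P.gradF (P.run R x0 xl0 (n + 1)).xLow)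
          (P.shift R x0 xl0 n)) := by
    rw [inner_sub_right, real_inner_smul_right, ← inner_add_left, sub_add_sub_cancel]
  rw [e3] at h3'
  have h7 := betaK_mul_lamK h.mu_nonneg h.L_pos n
  simp only [inner_sub_right (P.gradF (P.run R x0 xl0 (n + 1)).xLow)] at h3' h4'
  rw [← h7] at h2 ⊢
  linarith

theorem Assumptions.available_le (h : P.Assumptions) (hR : 0 < R) (hx0 : x0 ∈ P.feasible)
    (hw : w ∈ P.feasible) {n : ℕ} (hn : 1 ≤ n) :
    P.available R x0 xl0 v w z n ≤ P.potential R x0 xl0 v w z n := by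
  have hL := h.L_pos
  have hβ := betaK_pos h.mu_nonneg hL (k := n + 1) (by omega)
  have hT : (0 : ℝ) < P.TK R n := by
    exact_mod_cast TK_pos h.mu_nonneg hL hR h.opNorm_pos hn
  have hT' : (0 : ℝ) < P.TK R (n + 1) := by
    exact_mod_cast TK_pos h.mu_nonneg hL hR h.opNorm_pos (k := n + 1) (by omega)
  -- The first `α` of an outer iteration rescales the coupling weight to that of the previous one.
  have e : P.betaK (n + 1) / P.TK R (n + 1) * P.alphaKT R (n + 1) 1 =
      P.betaK n / P.TK R n := by
    rw [alphaKT, if_pos ⟨by omega, rfl⟩, Nat.add_sub_cancel]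
    field_simp
  have h1 := mul_le_mul_of_nonneg_right (two_betaK_mul_pK_le h.mu_nonneg hL hn)
    (h.V_nonneg (h.run_x_feasible (R := R) (xl0 := xl0) hx0 n) hw)
  have h2 := mul_le_mul_of_nonneg_right (betaK_mul_tauK_le h.mu_nonneg hL n)
    (h.bregF_nonneg (P.run R x0 xl0 n).xLow v)
  rw [available, potential, e]
  linarith

/-- Initially all increments vanish, `z₀ = 0`, and `τ_1 = 0` removes the arbitrary point `x̲_0`. -/
theorem available_zero (P : Problem m d ρ) (R : ℝ) (x0 xl0 v w : Net (Fin m) d) (z : Net ρ d) :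
    P.available R x0 xl0 v w z 0 =
      P.L / (4 * R ^ 2) * ‖z‖ ^ 2 + 4 * P.L * P.V x0 w := by
  rw [available, betaK_zero, zero_add, tauK_one, betaK_one, pK_one]
  simp only [run, sub_self, A_eq, map_zero, coupling, norm_zero, inner_zero_left, zero_sub,
    norm_neg]
  ring

/-- Smoothness with `s = -(1 + τ_n)⁻¹` bounds the inner product by the Bregman distance and the
squared shift, using `L ≤ p_n (1 + τ_n)`. -/
theorem Assumptions.potential_nonneg (h : P.Assumptions) (hR : 0 < R) (hx0 : x0 ∈ P.feasible)
    (hw : w ∈ P.feasible) {n : ℕ} (hn : 1 ≤ n) : 0 ≤ P.potential R x0 xl0 v w z n := by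
  have hL := h.L_pos
  have hμ := h.mu_nonneg
  have hβ := betaK_pos hμ hL hn
  have hp := pK_pos hL (P := P) hn
  have hτ := tauK_nonneg (P := P) hn
  have h0 := coupling_nonneg (c := P.L / (4 * R ^ 2)) (by positivity) (P.betaK n / P.TK R n) z
    (P.A ((P.run R x0 xl0 n).x - (P.run R x0 xl0 n).xTail)) (P.run R x0 xl0 n).z
  have h1 := h.V_nonneg (h.run_x_feasible (R := R) (xl0 := xl0) hx0 n) hw
  have h2 : 0 ≤ P.betaK n * (2 * P.pK n + P.μ) * P.V (P.run R x0 xl0 n).x w := by positivity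
  have h3 := h.inner_gradF_sub_le (P.run R x0 xl0 n).xLow v (P.shift R x0 xl0 n)
    (-(1 + P.tauK n)⁻¹)
  have h4 := mul_le_mul_of_nonneg_left h3 (by positivity : 0 ≤ P.betaK n * (1 + P.tauK n))
  have e1 : P.betaK n * (1 + P.tauK n) * (-(1 + P.tauK n)⁻¹ *
      inner ℝ (P.gradF (P.run R x0 xl0 n).xLow - P.gradF v) (P.shift R x0 xl0 n)) =
      P.betaK n * inner ℝ (P.gradF v - P.gradF (P.run R x0 xl0 n).xLow)
        (P.shift R x0 xl0 n) := by
    rw [← neg_sub (P.gradF v), inner_neg_left]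
    field_simp
  have e2 : P.betaK n * (1 + P.tauK n) * (P.bregF (P.run R x0 xl0 n).xLow v
      + P.L / 2 * (-(1 + P.tauK n)⁻¹) ^ 2 * P.netNorm (P.shift R x0 xl0 n) ^ 2) =
      P.betaK n * (1 + P.tauK n) * P.bregF (P.run R x0 xl0 n).xLow v
      + P.betaK n / 2 * (P.L / (1 + P.tauK n)) * P.netNorm (P.shift R x0 xl0 n) ^ 2 := by
    field_simp
  rw [e1, e2] at h4
  have h5 : P.L / (1 + P.tauK n) ≤ P.pK n := by
    rw [div_le_iff₀ (by positivity)]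
    exact L_le_pK_mul hμ hL hn
  have h6 : P.betaK n / 2 * (P.L / (1 + P.tauK n)) * P.netNorm (P.shift R x0 xl0 n) ^ 2 ≤
      P.betaK n / 2 * P.pK n * P.netNorm (P.shift R x0 xl0 n) ^ 2 := by gcongr
  rw [potential]
  linarith

theorem Assumptions.sum_gap_le (h : P.Assumptions) (hR : 0 < R) (hx0 : x0 ∈ P.feasible)
    (hw : w ∈ P.feasible) (hAw : P.A w = 0) {N : ℕ} (hN : 1 ≤ N) :
    ∑ k ∈ Icc 1 N, P.betaK k * (P.gapObj v z (P.run R x0 xl0 k).xHat - P.f w) ≤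
      P.L / (4 * R ^ 2) * ‖z‖ ^ 2 + 4 * P.L * P.V x0 w := by
  -- The final potential is kept in the bound so that the induction closes.
  suffices hs : ∑ k ∈ Icc 1 N, P.betaK k * (P.gapObj v z (P.run R x0 xl0 k).xHat - P.f w) ≤
      P.L / (4 * R ^ 2) * ‖z‖ ^ 2 + 4 * P.L * P.V x0 w - P.potential R x0 xl0 v w z N by
    have := h.potential_nonneg (xl0 := xl0) (v := v) (z := z) hR hx0 hw hN
    linarith
  induction N, hN using Nat.le_induction with
  | base =>
    have h1 := h.outer_progress (xl0 := xl0) (v := v) (z := z) hR hx0 hw hAw 0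
    rw [available_zero] at h1
    simpa using h1
  | succ n hn ih =>
    rw [sum_Icc_succ_top (by omega)]
    have h1 := h.outer_progress (xl0 := xl0) (v := v) (z := z) hR hx0 hw hAw n
    have h2 := h.available_le (xl0 := xl0) (v := v) (z := z) hR hx0 hw hn
    linarith

theorem Assumptions.output_jensen (h : P.Assumptions) (hR : 0 < R) (hx0 : x0 ∈ P.feasible)
    {N : ℕ} (hN : 1 ≤ N) :
    P.output R x0 xl0 N ∈ P.feasible ∧ ∀ g : Net (Fin m) d → ℝ, ConvexOn ℝ P.feasible g →
      (∑ k ∈ Icc 1 N, P.betaK k) * g (P.output R x0 xl0 N) ≤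
        ∑ k ∈ Icc 1 N, P.betaK k * g (P.run R x0 xl0 k).xHat := by
  have hpos := sum_betaK_pos h.mu_nonneg h.L_pos hN
  set B := ∑ k ∈ Icc 1 N, P.betaK k with hB
  have hw : ∀ k ∈ Icc 1 N, 0 ≤ B⁻¹ * P.betaK k := fun k hk =>
    mul_nonneg (inv_nonneg.2 hpos.le) (betaK_pos h.mu_nonneg h.L_pos (mem_Icc.1 hk).1).le
  have hsum : ∑ k ∈ Icc 1 N, B⁻¹ * P.betaK k = 1 := by
    rw [← mul_sum, inv_mul_cancel₀ hpos.ne']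
  have hmem : ∀ k ∈ Icc 1 N, (P.run R x0 xl0 k).xHat ∈ P.feasible := by
    intro k hk
    obtain ⟨n, rfl⟩ := Nat.exists_eq_add_of_le' (mem_Icc.1 hk).1
    exact (h.xHat_jensen hR hx0 n).1
  have hout : P.output R x0 xl0 N =
      ∑ k ∈ Icc 1 N, (B⁻¹ * P.betaK k) • (P.run R x0 xl0 k).xHat := by
    rw [output, smul_sum]
    exact sum_congr rfl fun k _ => smul_smul _ _ _
  refine ⟨?_, fun g hg => ?_⟩
  · rw [hout]
    exact h.feasible_convex.sum_mem hw hsum hmem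
  · have h1 := hg.map_sum_le hw hsum hmem
    rw [← hout] at h1
    calc _ ≤ B * ∑ k ∈ Icc 1 N, (B⁻¹ * P.betaK k) • g (P.run R x0 xl0 k).xHat :=
          mul_le_mul_of_nonneg_left h1 hpos.le
      _ = _ := by
        rw [mul_sum]
        refine sum_congr rfl fun k _ => ?_
        rw [smul_eq_mul, ← mul_assoc, ← mul_assoc, mul_inv_cancel₀ hpos.ne', one_mul]

/-- The primal-dual gap of the output. -/
theorem Assumptions.gap_le (h : P.Assumptions) (hR : 0 < R) (hx0 : x0 ∈ P.feasible)
    (hw : w ∈ P.feasible) (hAw : P.A w = 0) (z : Net ρ d) {N : ℕ} (hN : 1 ≤ N) :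
    (∑ k ∈ Icc 1 N, P.betaK k) * (P.f (P.output R x0 xl0 N) - P.f w
        + inner ℝ (P.A (P.output R x0 xl0 N)) z) ≤
      P.L / (4 * R ^ 2) * ‖z‖ ^ 2 + 4 * P.L * P.V x0 w := by
  -- The linearization point is chosen only now, as the output itself.
  have h1 := (h.output_jensen (xl0 := xl0) hR hx0 hN).2 _
    (h.gapObj_convex (P.output R x0 xl0 N) z)
  have h2 := h.sum_gap_le (xl0 := xl0) (v := P.output R x0 xl0 N) (z := z) hR hx0 hw hAw hN
  have h3 : P.gapObj (P.output R x0 xl0 N) z (P.output R x0 xl0 N) =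
      P.f (P.output R x0 xl0 N) + inner ℝ (P.A (P.output R x0 xl0 N)) z := by
    rw [gapObj, sub_self, inner_zero_right, f_eq]
    ring
  simp only [mul_sub, sum_sub_distrib] at h2
  rw [← sum_mul] at h2
  rw [h3] at h1
  linarith

theorem IsSaddle.A_eq_zero {xs : Net (Fin m) d} {zs : Net ρ d} (hs : P.IsSaddle xs zs) :
    P.A xs = 0 := by
  have h1 := hs.2.1 (zs + P.A xs)
  rw [inner_add_right] at h1
  have h2 := real_inner_self_nonneg (x := P.A xs)
  exact inner_self_eq_zero (𝕜 := ℝ) |>.1 (by linarith)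

theorem Assumptions.convergence (h : P.Assumptions) (hx0 : x0 ∈ P.feasible)
    {xs : Net (Fin m) d} {zs : Net ρ d} (hs : P.IsSaddle xs zs) (hR : 0 < R) {N : ℕ}
    (hN : 1 ≤ N) :
    P.output R x0 xl0 N ∈ P.feasible ∧
      P.f (P.output R x0 xl0 N) - P.f xs ≤ P.rate N * (4 * P.L * P.V x0 xs) ∧
      ‖P.A (P.output R x0 xl0 N)‖ ≤
        P.rate N * (P.L / (4 * R ^ 2) * (‖zs‖ + 1) ^ 2 + 4 * P.L * P.V x0 xs) := by
  have hL := h.L_pos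
  have hA := hs.A_eq_zero
  have hB := sum_betaK_pos h.mu_nonneg hL hN
  have hV := h.V_nonneg hx0 hs.1
  have hfeas := (h.output_jensen (xl0 := xl0) hR hx0 hN).1
  have hrate : ∀ a C : ℝ, 0 ≤ C → (∑ k ∈ Icc 1 N, P.betaK k) * a ≤ C → a ≤ P.rate N * C := by
    intro a C hC hle
    calc a = (∑ k ∈ Icc 1 N, P.betaK k)⁻¹ * ((∑ k ∈ Icc 1 N, P.betaK k) * a) :=
          (inv_mul_cancel_left₀ hB.ne' a).symm
      _ ≤ (∑ k ∈ Icc 1 N, P.betaK k)⁻¹ * C := by gcongr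
      _ ≤ P.rate N * C := by
        gcongr
        exact inv_sum_betaK_le_rate h.mu_nonneg hL hN
  refine ⟨hfeas, hrate _ _ (by positivity) ?_, hrate _ _ (by positivity) ?_⟩
  -- The multiplier `z = 0` isolates the objective.
  · have h1 := h.gap_le (xl0 := xl0) hR hx0 hs.1 hA 0 hN
    simpa using h1
  · set a := P.A (P.output R x0 xl0 N) with ha
    by_cases ha0 : a = 0
    · rw [ha0, norm_zero, mul_zero]
      positivity
    have hpos : 0 < ‖a‖ := norm_pos_iff.2 ha0
    have h1 := h.gap_le (xl0 := xl0) hR hx0 hs.1 hA (((‖zs‖ + 1) * ‖a‖⁻¹) • a) hN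
    rw [← ha, real_inner_smul_right, real_inner_self_eq_norm_sq, norm_smul, norm_mul,
      norm_inv, norm_norm, Real.norm_of_nonneg (by positivity : 0 ≤ ‖zs‖ + 1),
      inv_mul_cancel_right₀ hpos.ne'] at h1
    have e : (‖zs‖ + 1) * ‖a‖⁻¹ * ‖a‖ ^ 2 = (‖zs‖ + 1) * ‖a‖ := by field_simp
    rw [e] at h1
    -- The saddle inequality and Cauchy-Schwarz give `f(x̄) - f(x*) ≥ -‖z*‖ ‖a‖`, so the gap is at
    -- least `‖a‖`.
    have h2 := hs.2.2 _ hfeas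
    rw [hA, inner_zero_left, ← ha] at h2
    have h3 := real_inner_le_norm a zs
    refine le_trans (mul_le_mul_of_nonneg_left ?_ hB.le) h1
    linarith

end OuterLoop

/-! ### Iteration and communication complexity. -/

section Complexity

variable {m d : ℕ} {ρ : Type} {P : Problem m d ρ}

theorem rate_le_sublinear (P : Problem m d ρ) (N : ℕ) : P.rate N ≤ 2 / (N : ℝ) ^ 2 := by
  rw [rate]
  split_ifs
  · exact le_rfl
  · exact min_le_left _ _

theorem rate_le_linear (hμ : 0 < P.μ) (n : ℕ) : P.rate (P.Delta + n) ≤ P.lam ^ n := by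
  rw [rate, if_neg hμ.ne']
  refine (min_le_right _ _).trans (le_of_eq ?_)
  rw [← Real.rpow_natCast]
  congr 1
  push_cast
  ring

/-- The number of iterations for the sublinear rate. -/
theorem rate_mul_le_of_ceil (P : Problem m d ρ) {D ε : ℝ} (hD : 0 < D) (hε : 0 < ε) {N : ℕ}
    (hN : N = ⌈4 * √(D / ε)⌉₊) : 1 ≤ N ∧ P.rate N * (8 * D) ≤ ε := by
  have hs : 0 < √(D / ε) := Real.sqrt_pos.2 (by positivity)
  have h1 : 1 ≤ N := by
    rw [hN, Nat.one_le_iff_ne_zero, ← Nat.pos_iff_ne_zero, Nat.ceil_pos]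
    positivity
  have h2 : 4 * √(D / ε) ≤ N := by
    rw [hN]
    exact Nat.le_ceil _
  have hN0 : (0 : ℝ) < N := by exact_mod_cast h1
  refine ⟨h1, ?_⟩
  have h3 : 16 * (D / ε) ≤ (N : ℝ) ^ 2 := by
    calc 16 * (D / ε) = (4 * √(D / ε)) ^ 2 := by
          rw [mul_pow, Real.sq_sqrt (by positivity)]
          norm_num
      _ ≤ (N : ℝ) ^ 2 := by gcongr
  calc P.rate N * (8 * D) ≤ 2 / (N : ℝ) ^ 2 * (8 * D) := by
        gcongr
        exact P.rate_le_sublinear N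
    _ ≤ ε := by
        rw [div_mul_eq_mul_div, div_le_iff₀ (by positivity)]
        rw [mul_div_assoc', div_le_iff₀ hε] at h3
        linarith

/-- If the ceiling exceeds `1` then `a > 1`, and `(a + 1)(a + 2) ≤ 6 a²`. With `a = 4 √(L V / ε)`
this is the source of `96 = 6 · 16`. -/
theorem ceil_mul_succ_le {a : ℝ} (ha : 0 < a) :
    (⌈a⌉₊ : ℝ) * (⌈a⌉₊ + 1) ≤ max (6 * a ^ 2) 2 := by
  have h1 := Nat.ceil_lt_add_one ha.le
  rcases le_or_gt ⌈a⌉₊ 1 with h | h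
  · refine le_trans ?_ (le_max_right _ _)
    have : (⌈a⌉₊ : ℝ) ≤ 1 := by exact_mod_cast h
    nlinarith [(Nat.cast_nonneg ⌈a⌉₊ : (0 : ℝ) ≤ ⌈a⌉₊)]
  · refine le_trans ?_ (le_max_left _ _)
    have h2 : (2 : ℝ) ≤ ⌈a⌉₊ := by exact_mod_cast h
    have h3 : 1 < a := by
      have := Nat.lt_ceil.1 h
      simpa using this
    nlinarith

/-- The number of iterations for the linear rate. -/
theorem exists_pow_lam_le (hμ : 0 < P.μ) (hL : 0 < P.L) {D ε : ℝ} (hD : 0 < D) (hε : 0 < ε)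
    (hlog : 1 < Real.log (D / ε)) :
    ∃ n : ℕ, P.lam ^ n * (8 * D) ≤ ε ∧ (n : ℝ) ≤ (1 + P.tau) * (3 + Real.log (D / ε)) + 1 ∧
      (√P.lam ^ n)⁻¹ ≤ √(8 * D / P.lam) * (1 / √ε) := by
  have hl := lam_pos hμ hL
  have hτ := tau_pos hμ hL
  set x := Real.log (8 * D / ε) / (-Real.log P.lam) with hx
  -- From `log λ ≤ λ - 1`: an iteration gains at least `1 / (1 + τ)` in the logarithm.
  have hloglam : 1 / (1 + P.tau) ≤ -Real.log P.lam := by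
    have h1 := Real.log_le_sub_one_of_pos hl
    have h2 : P.lam - 1 = -(1 / (1 + P.tau)) := by
      rw [lam]
      field_simp
      ring
    linarith
  have hpos : 0 < -Real.log P.lam := lt_of_lt_of_le (by positivity) hloglam
  have hlog8 : Real.log (8 * D / ε) = Real.log 8 + Real.log (D / ε) := by
    rw [mul_div_assoc, Real.log_mul (by norm_num) (by positivity)]
  have h8 : Real.log 8 ≤ 3 := by
    rw [Real.log_le_iff_le_exp (by norm_num)]
    have h1 := Real.add_one_le_exp (1 : ℝ)
    have h2 : Real.exp 3 = Real.exp 1 ^ 3 := by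
      rw [← Real.exp_nat_mul]
      norm_num
    rw [h2]
    have h3 : (2 : ℝ) ^ 3 ≤ Real.exp 1 ^ 3 := by
      apply pow_le_pow_left₀ (by norm_num)
      linarith
    linarith
  have h80 : 0 ≤ Real.log 8 := Real.log_nonneg (by norm_num)
  have hx0 : 0 ≤ x := div_nonneg (by linarith) hpos.le
  have hpow : ∀ n : ℕ, P.lam ^ n = Real.exp (-(n * -Real.log P.lam)) := by
    intro n
    rw [mul_neg, neg_neg, Real.exp_nat_mul, Real.exp_log hl]
  have hxm : x * -Real.log P.lam = Real.log (8 * D / ε) := div_mul_cancel₀ _ hpos.ne'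
  have hexp : Real.exp (-Real.log (8 * D / ε)) = ε / (8 * D) := by
    rw [Real.exp_neg, Real.exp_log (by positivity), inv_div]
  refine ⟨⌈x⌉₊, ?_, ?_, ?_⟩
  · rw [hpow, ← le_div_iff₀ (by positivity), ← hexp, ← hxm]
    apply Real.exp_le_exp.2
    have := Nat.le_ceil x
    nlinarith
  · have h1 := Nat.ceil_lt_add_one hx0
    have h2 : x ≤ (1 + P.tau) * (3 + Real.log (D / ε)) := by
      rw [hx, div_le_iff₀ hpos]
      rw [div_le_iff₀ (by positivity)] at hloglam
      rw [hlog8]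
      nlinarith
    linarith
  · have h1 := Nat.ceil_lt_add_one hx0
    -- Rounding up overshoots by less than one factor `λ`, so `λ^n` is not much smaller than
    -- required. This keeps the last `T_k` of order `1 / √ε`.
    have h2 : ε / (8 * D) * P.lam ≤ P.lam ^ ⌈x⌉₊ := by
      have e : ε / (8 * D) * P.lam = Real.exp (-((x + 1) * -Real.log P.lam)) := by
        rw [add_mul, hxm, neg_add, Real.exp_add, hexp, one_mul, neg_neg, Real.exp_log hl]
      rw [hpow, e]
      apply Real.exp_le_exp.2
      nlinarith
    have e1 : (√P.lam ^ ⌈x⌉₊) = √(P.lam ^ ⌈x⌉₊) := by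
      symm
      rw [Real.sqrt_eq_iff_mul_self_eq (by positivity) (by positivity), ← mul_pow,
        Real.mul_self_sqrt hl.le]
    rw [e1, ← Real.sqrt_inv, mul_one_div, ← Real.sqrt_div (by positivity)]
    apply Real.sqrt_le_sqrt
    refine inv_le_of_inv_le₀ (by positivity) (le_trans (le_of_eq ?_) h2)
    field_simp

variable [Fintype ρ] {R : ℝ}
  {x0 xl0 xs : Net (Fin m) d} {zs : Net ρ d}

theorem TK_sub_one_le_early (hL : 0 < P.L) (hR : 0 < R) (hA : 0 < P.opNorm) {k : ℕ}
    (hk : P.early k) : (P.TK R k : ℝ) - 1 ≤ R * P.opNorm / P.L * k := by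
  rw [TK_early hk]
  have := Nat.ceil_lt_add_one (a := k * R * P.opNorm / P.L) (by positivity)
  have e : R * P.opNorm / P.L * k = k * R * P.opNorm / P.L := by ring
  rw [e]
  linarith

theorem TK_sub_one_le_late (hμ : 0 < P.μ) (hL : 0 < P.L) (hR : 0 < R) (hA : 0 < P.opNorm)
    (n : ℕ) : (P.TK R (P.Delta + (n + 1)) : ℝ) - 1 ≤
      R * P.opNorm / P.L * (2 * (1 + P.tau) * (√P.lam ^ (n + 1))⁻¹) := by
  have hl := lam_pos hμ hL
  have hτ := tau_pos hμ hL
  rw [TK_late n hμ]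
  have := Nat.ceil_lt_add_one
    (a := 2 * (1 + P.tau) * R * P.opNorm / (P.L * √P.lam ^ (n + 1))) (by positivity)
  have e : R * P.opNorm / P.L * (2 * (1 + P.tau) * (√P.lam ^ (n + 1))⁻¹) =
      2 * (1 + P.tau) * R * P.opNorm / (P.L * √P.lam ^ (n + 1)) := by
    field_simp
  rw [e]
  linarith

/-- The `Δ` early terms are each at most a multiple of `Δ`. The late ones form a growing geometric
sum, and dividing by `1 - √λ` makes the bound at `n + 1` exceed that at `n` by exactly the new term.
-/
theorem sum_TK_sub_one_le (hμ : 0 < P.μ) (hL : 0 < P.L) (hR : 0 < R) (hA : 0 < P.opNorm)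
    (n : ℕ) : ∑ k ∈ Icc 1 (P.Delta + n), ((P.TK R k : ℝ) - 1) ≤
      R * P.opNorm / P.L * ((P.Delta : ℝ) ^ 2
        + 2 * (1 + P.tau) / (1 - √P.lam) * (√P.lam ^ n)⁻¹) := by
  have hl := lam_pos hμ hL
  have hτ := tau_pos hμ hL
  have hσ : 0 < √P.lam := Real.sqrt_pos.2 hl
  have hσ1 : 0 < 1 - √P.lam := by
    have : √P.lam < 1 := by
      rw [Real.sqrt_lt' one_pos, one_pow]
      exact P.lam_lt_one
    linarith
  induction n with
  | zero =>
    have h1 : ∑ k ∈ Icc 1 P.Delta, ((P.TK R k : ℝ) - 1) ≤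
        ∑ k ∈ Icc 1 P.Delta, R * P.opNorm / P.L * (P.Delta : ℝ) := by
      refine sum_le_sum fun k hk => ?_
      have hk' := (mem_Icc.1 hk).2
      refine (TK_sub_one_le_early hL hR hA (Or.inr hk')).trans ?_
      gcongr
    rw [sum_const, Nat.card_Icc, Nat.add_sub_cancel, nsmul_eq_mul] at h1
    have h2 : 0 ≤ R * P.opNorm / P.L * (2 * (1 + P.tau) / (1 - √P.lam) * (√P.lam ^ 0)⁻¹) := by
      positivity
    rw [add_zero]
    nlinarith
  | succ n ih =>
    rw [← add_assoc, sum_Icc_succ_top (by omega)]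
    have h1 := TK_sub_one_le_late hμ hL hR hA n
    have e : R * P.opNorm / P.L * ((P.Delta : ℝ) ^ 2
          + 2 * (1 + P.tau) / (1 - √P.lam) * (√P.lam ^ (n + 1))⁻¹) =
        R * P.opNorm / P.L * ((P.Delta : ℝ) ^ 2
          + 2 * (1 + P.tau) / (1 - √P.lam) * (√P.lam ^ n)⁻¹)
        + R * P.opNorm / P.L * (2 * (1 + P.tau) * (√P.lam ^ (n + 1))⁻¹) := by
      rw [pow_succ]
      field_simp
      ring
    rw [e]
    exact add_le_add ih h1

theorem run_comms_eq (N : ℕ) : ((P.run R x0 xl0 N).comms : ℝ) =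
    2 * N + 2 * ∑ k ∈ Icc 1 N, ((P.TK R k : ℝ) - 1) := by
  rw [run_comms, sum_sub_distrib, sum_const, Nat.card_Icc, Nat.add_sub_cancel, nsmul_eq_mul,
    ← mul_sum]
  push_cast
  ring

theorem Assumptions.comms_le_strong (h : P.Assumptions) (hμ : 0 < P.μ) (hR : 0 < R) {N n : ℕ}
    (hN : N ≤ P.Delta + n) :
    ((P.run R x0 xl0 N).comms : ℝ) ≤ 2 * N + 2 * (R * P.opNorm / P.L * ((P.Delta : ℝ) ^ 2
        + 2 * (1 + P.tau) / (1 - √P.lam) * (√P.lam ^ n)⁻¹)) := by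
  rw [run_comms_eq]
  have h1 : ∑ k ∈ Icc 1 N, ((P.TK R k : ℝ) - 1) ≤
      ∑ k ∈ Icc 1 (P.Delta + n), ((P.TK R k : ℝ) - 1) := by
    refine sum_le_sum_of_subset_of_nonneg (Icc_subset_Icc_right hN) fun k hk _ => ?_
    have : (1 : ℝ) ≤ P.TK R k := by
      exact_mod_cast TK_pos h.mu_nonneg h.L_pos hR h.opNorm_pos (mem_Icc.1 hk).1
    linarith
  have h2 := sum_TK_sub_one_le hμ h.L_pos hR h.opNorm_pos n
  linarith

theorem Assumptions.comms_le_of_mu_eq_zero (h : P.Assumptions) (hμ : P.μ = 0) (hR : 0 < R)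
    (N : ℕ) : ((P.run R x0 xl0 N).comms : ℝ) ≤
      2 * N + R * P.opNorm / P.L * (N * (N + 1)) := by
  rw [run_comms_eq]
  have h1 : ∑ k ∈ Icc 1 N, ((P.TK R k : ℝ) - 1) ≤
      R * P.opNorm / P.L * (N * (N + 1)) / 2 := by
    induction N with
    | zero => simp
    | succ n ih =>
      rw [sum_Icc_succ_top (by omega)]
      have := TK_sub_one_le_early (P := P) h.L_pos hR h.opNorm_pos (k := n + 1) (Or.inl hμ)
      push_cast at this ⊢
      linarith
  linarith

theorem Rstar_pos (hV : 0 < P.V x0 xs) : 0 < P.Rstar x0 xs zs := by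
  have := Real.sqrt_pos.2 hV
  rw [Rstar]
  positivity

/-- The choice of `R` makes both terms of the feasibility bound equal to `4 L V(x₀, x*)`, whence the
factor `8`. -/
theorem Assumptions.isEpsSolution_output (h : P.Assumptions) (hx0 : x0 ∈ P.feasible)
    (hs : P.IsSaddle xs zs) (hV : 0 < P.V x0 xs) {ε : ℝ} {N : ℕ} (hN : 1 ≤ N)
    (hε : P.rate N * (8 * (P.L * P.V x0 xs)) ≤ ε) :
    P.IsEpsSolution xs ε (P.output (P.Rstar x0 xs zs) x0 xl0 N) := by
  have hL := h.L_pos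
  have hr := rate_pos h.mu_nonneg hL (P := P) hN
  obtain ⟨h1, h2, h3⟩ := h.convergence (xl0 := xl0) hx0 hs (Rstar_pos (zs := zs) hV) hN
  have e : P.L / (4 * P.Rstar x0 xs zs ^ 2) * (‖zs‖ + 1) ^ 2 = 4 * P.L * P.V x0 xs := by
    have hz : 0 < ‖zs‖ + 1 := by positivity
    have hsq := Real.sq_sqrt hV.le
    have := Real.sqrt_pos.2 hV
    rw [Rstar, div_pow, mul_pow, hsq]
    field_simp
  rw [e] at h3
  have h4 : 0 ≤ P.rate N * (4 * P.L * P.V x0 xs) := by positivity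
  exact ⟨h1, by linarith, by linarith⟩

theorem Assumptions.complexity_of_mu_eq_zero (h : P.Assumptions) (hx0 : x0 ∈ P.feasible)
    (hs : P.IsSaddle xs zs) (hne : x0 ≠ xs) (hμ : P.μ = 0) {ε : ℝ} (hε : 0 < ε) {N : ℕ}
    (hN : N = ⌈4 * √(P.L * P.V x0 xs / ε)⌉₊) :
    P.IsEpsSolution xs ε (P.output (P.Rstar x0 xs zs) x0 xl0 N) ∧
      ((P.run (P.Rstar x0 xs zs) x0 xl0 N).comms : ℝ) ≤
        2 * N + max (96 * P.V x0 xs / ε) (2 / P.L) * P.Rstar x0 xs zs * P.opNorm := by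
  have hL := h.L_pos
  have hV := h.V_pos hx0 hs.1 hne
  have hR := Rstar_pos (zs := zs) hV
  have hK := h.opNorm_pos
  obtain ⟨h1, h2⟩ := P.rate_mul_le_of_ceil (mul_pos hL hV) hε hN
  refine ⟨h.isEpsSolution_output hx0 hs hV h1 h2, ?_⟩
  refine (h.comms_le_of_mu_eq_zero hμ hR N).trans ?_
  have hs0 : 0 < √(P.L * P.V x0 xs / ε) := Real.sqrt_pos.2 (by positivity)
  have h3 := ceil_mul_succ_le (a := 4 * √(P.L * P.V x0 xs / ε)) (by positivity)
  rw [← hN, mul_pow, Real.sq_sqrt (by positivity)] at h3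
  have e : max (96 * P.V x0 xs / ε) (2 / P.L) =
      max (6 * (4 ^ 2 * (P.L * P.V x0 xs / ε))) 2 / P.L := by
    rw [← max_div_div_right hL.le]
    congr 1
    field_simp
    norm_num
  rw [e]
  have h4 := mul_le_mul_of_nonneg_left h3 (by positivity : 0 ≤ P.Rstar x0 xs zs * P.opNorm / P.L)
  have e2 : max (6 * (4 ^ 2 * (P.L * P.V x0 xs / ε))) 2 / P.L * P.Rstar x0 xs zs * P.opNorm =
      P.Rstar x0 xs zs * P.opNorm / P.L * max (6 * (4 ^ 2 * (P.L * P.V x0 xs / ε))) 2 := by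
    ring
  rw [e2]
  linarith

/-- The constant `C₁` of the complexity bound in the strongly convex case. -/
def gradConst (κ : ℝ) : ℝ := 7 * (2 + 1 / √κ)

/-- The constant `C₂` of the complexity bound in the strongly convex case. -/
def commConst (L μ V ζ : ℝ) : ℝ :=
  2 * ((ζ + 1) / (4 * √V) / L * ((2 * √(2 * L / μ) + 2) ^ 2
    + 2 * (1 + √(2 * L / μ)) / (1 - √(√(2 * L / μ) / (1 + √(2 * L / μ))))
      * ((√(√(2 * L / μ) / (1 + √(2 * L / μ))) ^ 7)⁻¹
        + √(8 * (L * V) / (√(2 * L / μ) / (1 + √(2 * L / μ)))))))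

theorem Assumptions.comms_le_commConst (h : P.Assumptions) (hμ : 0 < P.μ) (hV : 0 < P.V x0 xs)
    {ε : ℝ} (hε : 0 < ε) {N n : ℕ} (hN : N ≤ P.Delta + n)
    (hn : (√P.lam ^ n)⁻¹ ≤ ((√P.lam ^ 7)⁻¹ + √(8 * (P.L * P.V x0 xs) / P.lam)) * (1 + 1 / √ε)) :
    ((P.run (P.Rstar x0 xs zs) x0 xl0 N).comms : ℝ) ≤
      2 * N + commConst P.L P.μ (P.V x0 xs) ‖zs‖ * P.opNorm * (1 + 1 / √ε) := by
  have hL := h.L_pos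
  have hK := h.opNorm_pos
  have hR := Rstar_pos (zs := zs) hV
  have hτ := tau_pos hμ hL
  have hσ1 : 0 < 1 - √P.lam := by
    have : √P.lam < 1 := by
      rw [Real.sqrt_lt' one_pos, one_pow]
      exact P.lam_lt_one
    linarith
  have hD : (P.Delta : ℝ) ^ 2 ≤ (2 * P.tau + 2) ^ 2 :=
    pow_le_pow_left₀ (Nat.cast_nonneg _) P.Delta_le 2
  have hs : 0 < √ε := Real.sqrt_pos.2 hε
  have h1 := h.comms_le_strong (x0 := x0) (xl0 := xl0) hμ hR hN
  have e : commConst P.L P.μ (P.V x0 xs) ‖zs‖ * P.opNorm * (1 + 1 / √ε) =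
      2 * (P.Rstar x0 xs zs * P.opNorm / P.L * ((2 * P.tau + 2) ^ 2 * (1 + 1 / √ε)
        + 2 * (1 + P.tau) / (1 - √P.lam)
          * (((√P.lam ^ 7)⁻¹ + √(8 * (P.L * P.V x0 xs) / P.lam)) * (1 + 1 / √ε)))) := by
    simp only [commConst, Rstar, lam, tau]
    ring
  rw [e]
  refine h1.trans ?_
  gcongr
  refine hD.trans (le_mul_of_one_le_right (by positivity) ?_)
  have : 0 < 1 / √ε := by positivity
  linarith

/-- If `log (L V / ε) ≤ 1`, then `L V / ε ≤ e < 3`, and the sublinear rate needs at most `⌈4√3⌉ = 7`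
iterations. Otherwise the linear rate is run for `Δ + n` iterations, and the logarithm, being larger
than `1`, absorbs the additive constants. -/
theorem Assumptions.complexity_of_mu_pos (h : P.Assumptions) (hx0 : x0 ∈ P.feasible)
    (hs : P.IsSaddle xs zs) (hne : x0 ≠ xs) (hμ : 0 < P.μ) {ε : ℝ} (hε : 0 < ε) {κ : ℝ}
    (hκ : 0 < κ) (hκL : κ ≤ P.L / P.μ) :
    ∃ N : ℕ, P.IsEpsSolution xs ε (P.output (P.Rstar x0 xs zs) x0 xl0 N) ∧
      (N : ℝ) ≤ gradConst κ *
        (1 + √(P.L / P.μ) * max 0 (Real.log (P.L * P.V x0 xs / ε))) ∧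
      ((P.run (P.Rstar x0 xs zs) x0 xl0 N).comms : ℝ) ≤
        2 * N + commConst P.L P.μ (P.V x0 xs) ‖zs‖ * P.opNorm * (1 + 1 / √ε) := by
  have hL := h.L_pos
  have hV := h.V_pos hx0 hs.1 hne
  have hτ := tau_pos hμ hL
  have hl := lam_pos hμ hL
  have hσ : 0 < √P.lam := Real.sqrt_pos.2 hl
  have hD : 0 < P.L * P.V x0 xs := mul_pos hL hV
  have hsε : 0 < 1 / √ε := by
    have := Real.sqrt_pos.2 hε
    positivity
  have hκs : 0 < √κ := Real.sqrt_pos.2 hκ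
  have hκ1 : 0 < 1 / √κ := by positivity
  set D := P.L * P.V x0 xs with hDdef
  rcases le_or_gt (Real.log (D / ε)) 1 with hlog | hlog
  · obtain ⟨h1, h2⟩ := P.rate_mul_le_of_ceil hD hε (N := ⌈4 * √(D / ε)⌉₊) rfl
    have h3 : ⌈4 * √(D / ε)⌉₊ ≤ 7 := by
      apply Nat.ceil_le.2
      have h4 : D / ε ≤ 3 := by
        rw [Real.log_le_iff_le_exp (by positivity)] at hlog
        linarith [Real.exp_one_lt_d9]
      have h5 : √(D / ε) ≤ 7 / 4 := by
        rw [Real.sqrt_le_left (by norm_num)]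
        linarith
      push_cast
      linarith
    have h3' : (⌈4 * √(D / ε)⌉₊ : ℝ) ≤ 7 := by exact_mod_cast h3
    refine ⟨_, h.isEpsSolution_output hx0 hs hV h1 h2, ?_, ?_⟩
    · have h4 : 0 ≤ √(P.L / P.μ) * max 0 (Real.log (D / ε)) := by positivity
      rw [gradConst]
      nlinarith
    · refine h.comms_le_commConst hμ hV hε (n := 7) (by omega) ?_
      calc (√P.lam ^ 7)⁻¹ ≤ (√P.lam ^ 7)⁻¹ + √(8 * D / P.lam) := by
            linarith [Real.sqrt_nonneg (8 * D / P.lam)]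
        _ ≤ _ := le_mul_of_one_le_right (by positivity) (by linarith)
  · obtain ⟨n, hn1, hn2, hn3⟩ := exists_pow_lam_le hμ hL hD hε hlog
    have h1 : 1 ≤ P.Delta + n := by linarith [P.one_le_Delta]
    have h2 : P.rate (P.Delta + n) * (8 * D) ≤ ε :=
      (mul_le_mul_of_nonneg_right (rate_le_linear hμ n) (by positivity)).trans hn1
    refine ⟨_, h.isEpsSolution_output hx0 hs hV h1 h2, ?_, ?_⟩
    · have hΔ := P.Delta_le
      rw [max_eq_right (by linarith)]
      set s := Real.log (D / ε)
      set r := √(P.L / P.μ) with hr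
      have hr0 : √κ ≤ r := Real.sqrt_le_sqrt hκL
      -- The lower bound `κ` turns the `1` in `1 + τ` into a multiple of `√(L / μ)`.
      have h3 : 1 ≤ 1 / √κ * r := by
        rw [one_div_mul_eq_div, le_div_iff₀ hκs]
        linarith
      have h4 : P.tau ≤ 2 * r := by
        rw [tau, hr, Real.sqrt_le_left (by positivity), mul_pow, Real.sq_sqrt (by positivity),
          mul_div_assoc]
        have : 0 < P.L / P.μ := by positivity
        linarith
      push_cast
      have h5 : (P.Delta : ℝ) + n ≤ 7 * (1 + P.tau) * s := by nlinarith
      have h6 : 1 + P.tau ≤ (2 + 1 / √κ) * r := by linarith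
      calc (P.Delta : ℝ) + n ≤ 7 * (1 + P.tau) * s := h5
        _ ≤ 7 * ((2 + 1 / √κ) * r) * s := by gcongr
        _ ≤ gradConst κ * (1 + r * s) := by
          rw [gradConst]
          linarith
    · refine h.comms_le_commConst hμ hV hε le_rfl (hn3.trans ?_)
      gcongr
      · have : 0 < (√P.lam ^ 7)⁻¹ := by positivity
        linarith
      · linarith

end Complexity

end Problem

end PDS

end

theorem theorem2p2 :
    ∃ (C₁ : ℝ → ℝ) (C₂ : ℝ → ℝ → ℝ → ℝ → ℝ),
    ∀ (m d : ℕ) (ρ : Type) [Fintype ρ] (P : PDS.Problem m d ρ), P.Assumptions →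
    ∀ (x0 xl0 : PDS.Net (Fin m) d), x0 ∈ P.feasible → xl0 ∈ P.feasible →
    ∀ (xs : PDS.Net (Fin m) d) (zs : PDS.Net ρ d), P.IsSaddle xs zs →
    -- the convergence bounds
    (∀ R : ℝ, 0 < R → ∀ N : ℕ, 1 ≤ N →
      P.output R x0 xl0 N ∈ P.feasible ∧
      P.f (P.output R x0 xl0 N) - P.f xs ≤ P.rate N * (4 * P.L * P.V x0 xs) ∧
      ‖P.A (P.output R x0 xl0 N)‖ ≤
        P.rate N * (P.L / (4 * R ^ 2) * (‖zs‖ + 1) ^ 2 + 4 * P.L * P.V x0 xs)) ∧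
    -- the complexity bound in the case `μ = 0`
    (x0 ≠ xs → P.μ = 0 → ∀ R : ℝ, R = P.Rstar x0 xs zs → ∀ ε : ℝ, 0 < ε →
      ∀ N : ℕ, N = ⌈4 * √(P.L * P.V x0 xs / ε)⌉₊ →
        P.IsEpsSolution xs ε (P.output R x0 xl0 N) ∧
        (P.run R x0 xl0 N).grads ≤ N ∧
        ((P.run R x0 xl0 N).comms : ℝ) ≤
          2 * N + max (96 * P.V x0 xs / ε) (2 / P.L) * R * P.opNorm) ∧
    -- the complexity bound in the case `μ > 0`
    (x0 ≠ xs → 0 < P.μ → ∀ R : ℝ, R = P.Rstar x0 xs zs → ∀ ε : ℝ, 0 < ε →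
      ∀ κ : ℝ, 0 < κ → κ ≤ P.L / P.μ →
      ∃ N : ℕ,
        P.IsEpsSolution xs ε (P.output R x0 xl0 N) ∧
        (P.run R x0 xl0 N).grads ≤ N ∧
        (N : ℝ) ≤ C₁ κ * (1 + √(P.L / P.μ) * max 0 (Real.log (P.L * P.V x0 xs / ε))) ∧
        ((P.run R x0 xl0 N).comms : ℝ) ≤
          2 * N + C₂ P.L P.μ (P.V x0 xs) ‖zs‖ * P.opNorm * (1 + 1 / √ε)) := by
  refine ⟨PDS.Problem.gradConst, PDS.Problem.commConst, ?_⟩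
  intro m d ρ _ P h x0 xl0 hx0 _ xs zs hs
  refine ⟨fun R hR N hN => h.convergence hx0 hs hR hN, ?_, ?_⟩
  · rintro hne hμ R rfl ε hε N hN
    obtain ⟨h1, h2⟩ := h.complexity_of_mu_eq_zero (xl0 := xl0) hx0 hs hne hμ hε hN
    exact ⟨h1, (PDS.Problem.run_grads N).le, h2⟩
  · rintro hne hμ R rfl ε hε κ hκ hκL
    obtain ⟨N, h1, h2, h3⟩ := h.complexity_of_mu_pos (xl0 := xl0) hx0 hs hne hμ hε hκ hκL
    exact ⟨N, h1, (PDS.Problem.run_grads N).le, h2, h3⟩
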